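/- **Setting.** Let $D\subseteq\mathbb R$ be a Borel set, $\rho$ a probability measure on $D$, and $k:D\times D\to\mathbb R$ a measurable reproducing kernel (symmetric and positive semidefinite) with $k(a,a)=0$ for some $a\in D$, $M:=\int_D k(x,x)\,\rho(dx)<\infty$ and $C_0:=\int_D\int_D k(x,y)\,\rho(dx)\,\rho(dy)>0$. Let $\mathbb N=\{1,2,\dots\}$, let $\mathcal U$ be the set of finite subsets of $\mathbb N$, and let $\gamma=(\gamma_u)_{u\in\mathcal U}$ be non-negative weights with $\sum_{u}\gamma_uM^{|u|}<\infty$ and $\gamma_{\{1\}}>0$. Put $k_u(x,y)=\prod_{j\in u}k(x_j,y_j)$, $\mathcal X=\{x\in D^{\mathbb N}:\sum_u\gamma_uk_u(x,x)<\infty\}$ and $K_\gamma=\sum_u\gamma_uk_u$ on $\mathcal X\times\mathcal X$. Let $\mathcal H_\gamma=H(K_\gamma)$ be the reproducing kernel Hilbert space of $K_\gamma$, $B_\gamma$ its closed unit ball, and $I(f)=\int_{\mathcal X}f\,d\rho^{\mathbb N}$. Functions $f\in\mathcal H_\gamma$ are extended by $0$ to $D^{\mathbb N}\setminus\mathcal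 X$. **Algorithms and cost.** A randomized algorithm $Q$ is a random choice of a deterministic, possibly adaptive and non-linear, method based on function values. Let $\$:\mathbb N_0\to[1,\infty]$ be non-decreasing with $\$(\nu)=\Omega(\nu^s)$ as $\nu\to\infty$ for some $s\in(0,\infty)$. For $v\in\mathcal U$ put $\mathcal X_{v,a}=\{x\in D^{\mathbb N}:x_j=a\text{ for all }j\notin v\}$. In the unrestricted subspace sampling model the evaluation of $f$ at $x$ costs $c_a(x)=\inf\{\$(|u|):u\in\mathcal U,\ x\in\mathcal X_{u,a}\}$; ${\rm cost}(Q,f)$ is the sum of the costs of all function evaluations. The class $\mathcal A^{\rm ran}$ consists of all $Q$ such that for every $f\in\mathcal H_\gamma$ the result $Q(f)$ is a square-integrable random variable and ${\rm cost}(Q,f)$ is a random variable. The class $\mathcal A^{\rm res}$ consists of all $Q\in\mathcal A^{\rm ran}$ for which there are $n\in\mathbb N_0$ and $v_1,\dots,v_n\in\mathcal U$ such that, for every $f\in\mathcal H_\gamma$, $Q$ performs (almost surely) exactly $n$ function evaluations, the $i$th one at a point of $\mathcal X_{v_i,a}$, and $\mathbb E({\rm cost}(Q,f))=\sum_{i=1}^n\$(|v_i|)$.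 Put ${\rm cost}_{\rm unr}(Q)=\sup_{f\in B_\gamma}\mathbb E({\rm cost}(Q,f))$, $e(Q)=\sup_{f\in B_\gamma}\big(\mathbb E(I(f)-Q(f))^2\big)^{1/2}$ and, for $\varepsilon>0$, ${\rm comp}(\varepsilon)=\inf\{{\rm cost}_{\rm unr}(Q):Q\in\mathcal A^{\rm res},\ e(Q)\le\varepsilon\}$. The problem is strongly polynomially tractable for $\mathcal A^{\rm res}$ if there are $C,p\ge0$ with ${\rm comp}(\varepsilon)\le C\varepsilon^{-p}$ for all $\varepsilon>0$; the exponent $p^{\rm res}_{\rm unr}$ is the infimum of all such $p\ge 0$ ($\infty$ if there are none). Let $\alpha>0$ be such that for univariate integration $f\mapsto\int_Df\,d\rho$ on the unit ball of $H(\gamma_{\{1\}}k)$ the minimal worst case root mean square error $e^{\rm ran}(N)$ of randomized algorithms (for which results are square-integrable random variables and costs are random variables, every function evaluation costing $\$(1)$) of worst case expected cost at most $N$ satisfies $e^{\rm ran}(N)=\Omega(N^{-\alpha/2})$ as $N\to\infty$. **Decay.** For $\sigma\in\mathbb N$ let $\gamma^{(\sigma)}_u=\gamma_u$ if $|u|\le\sigma$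 and $\gamma^{(\sigma)}_u=0$ otherwise, $\widehat\gamma^{(\sigma)}_u=\gamma^{(\sigma)}_uC_0^{|u|}$, and let $u_1(\sigma),u_2(\sigma),\dots$ be the distinct non-empty $u\in\mathcal U$ with $\gamma^{(\sigma)}_u>0$, ordered such that $\widehat\gamma^{(\sigma)}_{u_1(\sigma)}\ge\widehat\gamma^{(\sigma)}_{u_2(\sigma)}\ge\cdots$. Put $${\rm decay}_{\gamma,\sigma}=\sup\Big\{p\in\mathbb R:\lim_{j\to\infty}\widehat\gamma^{(\sigma)}_{u_j(\sigma)}j^p=0\Big\}$$ ($\infty$ if there are only finitely many $u_j(\sigma)$), and let $t^*_\sigma\in[0,\infty]$ be the infimum of all $t\ge0$ for which there is a $C_t>0$ with $|\{i:u_i(\sigma)\subseteq v\}|\le C_t|v|^t$ for all $v\in\mathcal U$. **Theorem.** If the integration problem on $\mathcal H_\gamma$ is strongly polynomially tractable for the class $\mathcal A^{\rm res}$ in the unrestricted subspace sampling model, then ${\rm decay}_{\gamma,\sigma}>1$ for all $\sigma\in\mathbb N$. If ${\rm decay}_{\gamma,\sigma}>1$ for all $\sigma\in\mathbb N$, then $$p^{\rm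 res}_{\rm unr}\ \ge\ \max\Big\{\frac2\alpha,\ \sup_{\sigma\in\mathbb N}\frac{2\min\{1,s/t^*_\sigma\}}{{\rm decay}_{\gamma,\sigma}-1}\Big\},$$ where $s/0=\infty$ and $x/\infty=0$ for real $x$. -/

import Mathlib

open MeasureTheory Filter Topology
open scoped ENNReal

noncomputable section

namespace InfInt

/-! ### Reproducing kernel Hilbert spaces -/

/-- The operator-valued form of a real-valued kernel, as used by `RKHS.OfKernel`: the entry at
`(x, y)` is multiplication by `K x y`. -/
def opKernel {X : Type*} (K : X → X → ℝ) : Matrix X X (ℝ →L[ℝ] ℝ) :=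
  Matrix.of fun x y => K x y • ContinuousLinearMap.id ℝ ℝ

/-- A positive semidefinite real matrix is a positive semidefinite operator-valued kernel. -/
theorem posSemidef_opKernel {X : Type*} {K : X → X → ℝ}
    (hK : (Matrix.of K).PosSemidef) : (opKernel K).PosSemidef := by
  have key := (RKHS.posSemidef_tfae (K := opKernel K)).out 0 2
  rw [key]
  refine ⟨?_, fun v => ?_⟩
  · ext x y
    have h := hK.isHermitian.apply x y
    simp only [Matrix.of_apply, star_trivial] at h
    have h1 : star (ContinuousLinearMap.id ℝ ℝ) = ContinuousLinearMap.id ℝ ℝ :=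
      star_one (ℝ →L[ℝ] ℝ)
    simp [opKernel, Matrix.conjTranspose_apply, h, h1]
  · have h := hK.2 v
    simp only [Finsupp.sum, Matrix.of_apply, star_trivial] at h
    simp only [Finsupp.sum, opKernel, Matrix.of_apply, map_sum]
    rw [Finset.sum_comm]
    refine h.trans (le_of_eq ?_)
    refine Finset.sum_congr rfl fun i _ => Finset.sum_congr rfl fun j _ => ?_
    simp
    ring

/-- The functions in the reproducing kernel Hilbert space `H(K)` of a reproducing kernel `K`, i.e.
of a symmetric positive semidefinite function on `X × X`. (The existential quantifier over `hK`
only carries the proof that `K` is such a kernel.) -/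
def kernelSpace {X : Type*} (K : X → X → ℝ) : Set (X → ℝ) :=
  {f | ∃ hK : (opKernel K).PosSemidef,
    haveI : Fact (opKernel K).PosSemidef := ⟨hK⟩
    ∃ g : RKHS.OfKernel (opKernel K), (g : X → ℝ) = f}

/-- The closed norm unit ball `B(K)` of `H(K)`. -/
def kernelBall {X : Type*} (K : X → X → ℝ) : Set (X → ℝ) :=
  {f | ∃ hK : (opKernel K).PosSemidef,
    haveI : Fact (opKernel K).PosSemidef := ⟨hK⟩
    ∃ g : RKHS.OfKernel (opKernel K), ‖g‖ ≤ 1 ∧ (g : X → ℝ) = f}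

/-! ### Randomized algorithms -/

/-- A deterministic, possibly adaptive and nonlinear method that uses function values at points of
`X`. `next ys` is the next sample point once the values `ys` have been observed (in this order);
`next ys = none` means that the method stops, with result `output ys`. -/
structure AdaptiveMethod (X : Type*) where
  next : List ℝ → Option X
  output : List ℝ → ℝ

namespace AdaptiveMethod

variable {X : Type*} (A : AdaptiveMethod X) (f : X → ℝ)

/-- The values that have been observed after (at most) `i` steps on input `f`. -/
def history : ℕ → List ℝ
  | 0 => []
  | i + 1 => match A.next (history i) with
    | none => history i
    | some x => history i ++ [f x]

/-- The sample point of step `i` (counted from `0`) on input `f`, or `none` if the method has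
stopped before. -/
def node (i : ℕ) : Option X := A.next (A.history f i)

/-- The sum of the costs `c x` over all function evaluations made on input `f`. -/
def cost (c : X → ℝ≥0∞) : ℝ≥0∞ := ∑' i : ℕ, (A.node f i).elim 0 c

open Classical in
/-- The result on input `f` (`0` if the method never stops, in which case its cost is infinite as
soon as every evaluation has cost at least `1`). -/
def result : ℝ :=
  if h : ∃ i, A.node f i = none then A.output (A.history f (Nat.find h)) else 0

end AdaptiveMethod

/-- A randomized algorithm: a random choice of an adaptive method. -/
structure RandomizedAlgorithm (X : Type*) where
  Ω : Type
  [mΩ : MeasurableSpace Ω]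
  P : Measure Ω
  [isProb : IsProbabilityMeasure P]
  method : Ω → AdaptiveMethod X

attribute [instance] RandomizedAlgorithm.mΩ RandomizedAlgorithm.isProb

/-- An approximation problem for a functional, with information given by function values. -/
structure Problem (X : Type*) where
  /-- the space of integrands, as functions on the set of admissible oracle queries -/
  space : Set (X → ℝ)
  /-- the unit ball of the space -/
  ball : Set (X → ℝ)
  /-- the functional to be approximated -/
  functional : (X → ℝ) → ℝ
  /-- the cost of one function evaluation -/
  cost : X → ℝ≥0∞

namespace Problem

variable {X : Type*} (p : Problem X)

/-- The class of all randomized algorithms: for every integrand the result is a square-integrable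
random variable, and the cost is a random variable. -/
def ran : Set (RandomizedAlgorithm X) :=
  {Q | ∀ f ∈ p.space,
    MemLp (fun ω => (Q.method ω).result f) 2 Q.P ∧
    AEMeasurable (fun ω => (Q.method ω).cost f p.cost) Q.P}

/-- The worst case cost on the unit ball. -/
def worstCost (Q : RandomizedAlgorithm X) : ℝ≥0∞ :=
  ⨆ f ∈ p.ball, ∫⁻ ω, (Q.method ω).cost f p.cost ∂Q.P

/-- The randomized worst case error on the unit ball. -/
def error (Q : RandomizedAlgorithm X) : ℝ≥0∞ :=
  (⨆ f ∈ p.ball,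
    ∫⁻ ω, ENNReal.ofReal ((p.functional f - (Q.method ω).result f) ^ 2) ∂Q.P) ^ (1 / 2 : ℝ)

/-- The `N`th minimal error in a class `𝒜` of algorithms. -/
def minError (𝒜 : Set (RandomizedAlgorithm X)) (N : ℝ) : ℝ≥0∞ :=
  sInf {e | ∃ Q ∈ 𝒜, p.worstCost Q ≤ ENNReal.ofReal N ∧ e = p.error Q}

/-- The `ε`-complexity with respect to a class `𝒜` of algorithms. -/
def comp (𝒜 : Set (RandomizedAlgorithm X)) (ε : ℝ) : ℝ≥0∞ :=
  sInf {c | ∃ Q ∈ 𝒜, p.error Q ≤ ENNReal.ofReal ε ∧ c = p.worstCost Q}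

/-- `q` is an admissible exponent: `comp(ε) ≤ C ε^{-q}` for all `ε > 0`, with some constant `C`. -/
def PolyBound (𝒜 : Set (RandomizedAlgorithm X)) (q : ℝ) : Prop :=
  0 ≤ q ∧ ∃ C : ℝ, 0 ≤ C ∧ ∀ ε : ℝ, 0 < ε → p.comp 𝒜 ε ≤ ENNReal.ofReal (C * ε ^ (-q))

/-- Strong polynomial tractability with respect to the class `𝒜`. -/
def StronglyTractable (𝒜 : Set (RandomizedAlgorithm X)) : Prop :=
  ∃ q : ℝ, p.PolyBound 𝒜 q

/-- The exponent of strong polynomial tractability (`⊤` if the problem is not strongly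
polynomially tractable). -/
def exponent (𝒜 : Set (RandomizedAlgorithm X)) : EReal :=
  sInf ((fun q : ℝ => (q : EReal)) '' {q | p.PolyBound 𝒜 q})

end Problem

/-! ### Weighted infinite-dimensional integration

Coordinates are indexed by `ℕ+ = {1, 2, …}`, weights by finite sets of coordinates. -/

section Setting

variable {D : Set ℝ}

/-- The product kernel `k_u`, `u` a finite set of coordinates. -/
def prodKernel (k : D → D → ℝ) (u : Finset ℕ+) (x y : ℕ+ → D) : ℝ :=
  ∏ j ∈ u, k (x j) (y j)

/-- The domain `𝒳` of the functions of infinitely many variables. -/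
def domain (k : D → D → ℝ) (γ : Finset ℕ+ → ℝ) : Set (ℕ+ → D) :=
  {x | Summable fun u : Finset ℕ+ => γ u * prodKernel k u x x}

/-- The kernel `K_γ` on `𝒳`. -/
def weightedKernel (k : D → D → ℝ) (γ : Finset ℕ+ → ℝ) (x y : domain k γ) : ℝ :=
  ∑' u : Finset ℕ+, γ u * prodKernel k u x y

/-- Functions on a set `S`, extended by zero. -/
def extendZero {X : Type*} (S : Set X) (f : S → ℝ) : X → ℝ :=
  Function.extend Subtype.val f 0

/-- The affine subspace `𝒳_{v,a}`. -/
def sampleSpace (a : D) (v : Finset ℕ+) : Set (ℕ+ → D) :=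
  {x | ∀ j, j ∉ v → x j = a}

/-- The cost `c_a` of a function evaluation in the unrestricted subspace sampling model, `cst ν`
being the cost of an evaluation with `ν` active coordinates. -/
def unrCost (a : D) (cst : ℕ → ℝ≥0∞) (x : ℕ+ → D) : ℝ≥0∞ :=
  ⨅ (u : Finset ℕ+) (_ : x ∈ sampleSpace a u), cst u.card

/-- Integration over `𝒳` for functions in `H(K_γ)`, with unrestricted subspace sampling. The
oracle accepts all points of `D^ℕ` and returns `0` outside of `𝒳`. -/
def infProblem (k : D → D → ℝ) (a : D) (ρ : Measure D) (γ : Finset ℕ+ → ℝ)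
    (cst : ℕ → ℝ≥0∞) : Problem (ℕ+ → D) where
  space := extendZero (domain k γ) '' kernelSpace (weightedKernel k γ)
  ball := extendZero (domain k γ) '' kernelBall (weightedKernel k γ)
  functional f := ∫ x in domain k γ, f x ∂(Measure.infinitePi fun _ : ℕ+ => ρ)
  cost := unrCost a cst

/-- Univariate integration in `H(K)`, each function evaluation having cost `c₁`. -/
def uniProblem (K : D → D → ℝ) (ρ : Measure D) (c₁ : ℝ≥0∞) : Problem D where
  space := kernelSpace K
  ball := kernelBall K
  functional f := ∫ x, f x ∂ρ
  cost _ := c₁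

/-- The class `𝒜^res`: algorithms that use a fixed number `n` of samples, the `i`th one from a
fixed subspace `𝒳_{v_i,a}`, with expected cost equal to the sum of the `cst |v_i|`. -/
def res (p : Problem (ℕ+ → D)) (a : D) (cst : ℕ → ℝ≥0∞) :
    Set (RandomizedAlgorithm (ℕ+ → D)) :=
  {Q | Q ∈ p.ran ∧ ∃ (n : ℕ) (v : Fin n → Finset ℕ+), ∀ f ∈ p.space,
    (∀ᵐ ω ∂Q.P, (Q.method ω).node f n = none ∧
      ∀ i : Fin n, ∃ x ∈ sampleSpace a (v i), (Q.method ω).node f i = some x) ∧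
    ∫⁻ ω, (Q.method ω).cost f p.cost ∂Q.P = ∑ i, cst (v i).card}

/-! The kernel `K_γ` is indeed a reproducing kernel. -/

theorem posSemidef_prodKernel {k : D → D → ℝ} (hk : (Matrix.of k).PosSemidef) (u : Finset ℕ+) :
    (Matrix.of (prodKernel k u)).PosSemidef := by
  classical
  induction u using Finset.induction_on with
  | empty =>
    refine ⟨by ext; simp [prodKernel], fun x => ?_⟩
    have : (x.sum fun i xi => x.sum fun j xj => star xi * Matrix.of (prodKernel k ∅) i j * xj)
        = (x.sum fun _ xi => xi) * (x.sum fun _ xi => xi) := by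
      simp [Finsupp.sum, prodKernel, Finset.sum_mul_sum]
    rw [this]
    exact mul_self_nonneg _
  | insert j u hj ih =>
    have h1 := hk.submatrix (fun x : ℕ+ → D => x j)
    have h2 : Matrix.of (prodKernel k (insert j u)) =
        ((Matrix.of k).submatrix (fun x : ℕ+ → D => x j) fun x => x j).hadamard
          (Matrix.of (prodKernel k u)) := by
      ext x y
      simp [prodKernel, Finset.prod_insert hj]
    rw [h2]
    exact Matrix.PosSemidef.hadamard (𝕜 := ℝ) h1 ih

theorem posSemidef_weightedKernel {k : D → D → ℝ} (hk : (Matrix.of k).PosSemidef)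
    {γ : Finset ℕ+ → ℝ} (hγ : ∀ u, 0 ≤ γ u) :
    (Matrix.of (weightedKernel k γ)).PosSemidef := by
  have hsymm : ∀ (u : Finset ℕ+) (x y : ℕ+ → D), prodKernel k u x y = prodKernel k u y x := by
    intro u x y
    simpa using (posSemidef_prodKernel hk u).isHermitian.apply y x
  have hdiag : ∀ (u : Finset ℕ+) (x : ℕ+ → D), 0 ≤ prodKernel k u x x := fun u x =>
    (posSemidef_prodKernel hk u).diag_nonneg (i := x)
  have hbound : ∀ (u : Finset ℕ+) (x y : ℕ+ → D),
      |prodKernel k u x y| ≤ prodKernel k u x x + prodKernel k u y y := by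
    intro u x y
    have hpsd := ((posSemidef_prodKernel hk u).submatrix ![x, y])
    have h1 := hpsd.dotProduct_mulVec_nonneg ![1, 1]
    have h2 := hpsd.dotProduct_mulVec_nonneg ![1, -1]
    simp [Matrix.mulVec, dotProduct, Fin.sum_univ_two] at h1 h2
    have h3 := hsymm u x y
    have h4 := hdiag u x
    have h5 := hdiag u y
    rw [abs_le]
    constructor <;> linarith
  have hsummable : ∀ x y : domain k γ,
      Summable fun u : Finset ℕ+ => γ u * prodKernel k u x y := by
    intro x y
    refine Summable.of_norm_bounded (x.2.add y.2) fun u => ?_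
    rw [Real.norm_eq_abs, abs_mul, abs_of_nonneg (hγ u), ← mul_add]
    exact mul_le_mul_of_nonneg_left (hbound u x y) (hγ u)
  refine ⟨?_, fun c => ?_⟩
  · ext x y
    simp only [Matrix.conjTranspose_apply, Matrix.of_apply, star_trivial, weightedKernel]
    exact tsum_congr fun u => by rw [hsymm]
  · have hs : ∀ x y : domain k γ, Summable fun u : Finset ℕ+ =>
        c x * (γ u * prodKernel k u x y) * c y := fun x y =>
      ((hsummable x y).mul_left _).mul_right _
    have : (c.sum fun x cx => c.sum fun y cy => star cx * Matrix.of (weightedKernel k γ) x y * cy)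
        = ∑' u : Finset ℕ+, ∑ x ∈ c.support, ∑ y ∈ c.support,
            c x * (γ u * prodKernel k u x y) * c y := by
      rw [Summable.tsum_finsetSum fun x _ => summable_sum fun y _ => hs x y]
      refine Finset.sum_congr rfl fun x _ => ?_
      rw [Summable.tsum_finsetSum fun y _ => hs x y]
      refine Finset.sum_congr rfl fun y _ => ?_
      simp only [Matrix.of_apply, star_trivial, weightedKernel]
      rw [tsum_mul_right, tsum_mul_left]
    rw [this]
    refine tsum_nonneg fun u => ?_
    have h := ((posSemidef_prodKernel hk u).submatrix
      (Subtype.val : domain k γ → (ℕ+ → D))).2 c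
    simp only [Finsupp.sum, Matrix.submatrix_apply, Matrix.of_apply, star_trivial] at h
    have h' := mul_nonneg (hγ u) h
    rw [Finset.mul_sum] at h'
    refine h'.trans (le_of_eq (Finset.sum_congr rfl fun x _ => ?_))
    rw [Finset.mul_sum]
    exact Finset.sum_congr rfl fun y _ => by ring

end Setting

/-! ### Decay of weights -/

/-- The cut-off weights `γ^{(σ)}`. -/
def cutOff (γ : Finset ℕ+ → ℝ) (σ : ℕ) (u : Finset ℕ+) : ℝ :=
  if u.card ≤ σ then γ u else 0

/-- The weights `γ_u C₀^{|u|}`. -/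
def hatWeights (C₀ : ℝ) (γ : Finset ℕ+ → ℝ) (u : Finset ℕ+) : ℝ :=
  γ u * C₀ ^ u.card

/-- `u 0, u 1, …` lists the distinct nonempty sets of positive weight `γ`, each exactly once, in
nonincreasing order with respect to `w`. If there are only finitely many such sets, the list is
continued by `none`, to which the value `0` is assigned. -/
structure IsDecreasingList (γ w : Finset ℕ+ → ℝ) (u : ℕ → Option (Finset ℕ+)) : Prop where
  mem_iff : ∀ v, (v.Nonempty ∧ 0 < γ v) ↔ ∃ j, u j = some v
  inj : ∀ i j v, u i = some v → u j = some v → i = j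
  anti : Antitone fun j => (u j).elim 0 w

/-- Such a list exists for summable weights. -/
theorem exists_isDecreasingList {γ w : Finset ℕ+ → ℝ} (hw : Summable w)
    (hpos : ∀ v, 0 < γ v → 0 < w v) : ∃ u, IsDecreasingList γ w u := by
  classical
  let S : Set (Finset ℕ+) := {v | v.Nonempty ∧ 0 < γ v}
  have hfin : ∀ c : ℝ, 0 < c → {v | c ≤ w v}.Finite := by
    intro c hc
    have h := hw.tendsto_cofinite_zero.eventually (gt_mem_nhds hc)
    refine (Filter.eventually_cofinite.mp h).subset fun v hv => ?_
    exact not_lt.mpr hv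
  have hnx : ∀ F : Finset (Finset ℕ+), ∃ o : Option (Finset ℕ+),
      (o = none → S ⊆ F) ∧ ∀ v, o = some v → v ∈ S ∧ v ∉ F ∧ ∀ v' ∈ S, v' ∉ F → w v' ≤ w v := by
    intro F
    by_cases hF : S ⊆ F
    · exact ⟨none, fun _ => hF, by simp⟩
    · obtain ⟨v₀, hv₀, hv₀F⟩ := Set.not_subset.mp hF
      have hT : {v | v ∈ S ∧ v ∉ F ∧ w v₀ ≤ w v}.Finite :=
        (hfin _ (hpos _ hv₀.2)).subset fun v hv => hv.2.2
      obtain ⟨m, hm, hmax⟩ := hT.exists_maximalFor w _ ⟨v₀, hv₀, hv₀F, le_rfl⟩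
      refine ⟨some m, by simp, fun v hv => ?_⟩
      obtain rfl : m = v := by simpa using hv
      refine ⟨hm.1, hm.2.1, fun v' h1 h2 => ?_⟩
      rcases le_total (w v') (w m) with h | h
      · exact h
      · exact hmax ⟨h1, h2, hm.2.2.trans h⟩ h
  choose nx hnone hsome using hnx
  let F : ℕ → Finset (Finset ℕ+) := fun n =>
    Nat.rec ∅ (fun _ G => G ∪ (nx G).toFinset) n
  have hF : ∀ n, F (n + 1) = F n ∪ (nx (F n)).toFinset := fun n => rfl
  have hmono : Monotone F := monotone_nat_of_le_succ fun n => by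
    rw [hF]; exact Finset.subset_union_left
  have hmem : ∀ n v, v ∈ F n → ∃ j, nx (F j) = some v := by
    intro n
    induction n with
    | zero => intro v hv; exact absurd hv (Finset.notMem_empty v)
    | succ n ih =>
      intro v hv
      rw [hF, Finset.mem_union] at hv
      rcases hv with hv | hv
      · exact ih v hv
      · exact ⟨n, by simpa using hv⟩
  have hlt : ∀ i j v, i < j → nx (F i) = some v → nx (F j) ≠ some v := by
    intro i j v hij hi hj
    refine (hsome _ _ hj).2.1 (hmono (Nat.succ_le_of_lt hij) ?_)
    rw [Nat.succ_eq_add_one, hF, hi]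
    simp
  have hinj : ∀ i j v, nx (F i) = some v → nx (F j) = some v → i = j := by
    intro i j v hi hj
    rcases lt_trichotomy i j with h | h | h
    · exact absurd hj (hlt i j v h hi)
    · exact h
    · exact absurd hi (hlt j i v h hj)
  refine ⟨fun j => nx (F j), fun v => ⟨fun hv => ?_, fun ⟨j, hj⟩ => (hsome _ _ hj).1⟩, hinj, ?_⟩
  · by_contra hcon
    have hvF : ∀ n, v ∉ F n := fun n hn => hcon (hmem n v hn)
    have hall : ∀ n, ∃ v', nx (F n) = some v' := by
      intro n
      rcases h : nx (F n) with _ | v'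
      · exact absurd (hnone _ h hv) (hvF n)
      · exact ⟨v', rfl⟩
    choose g hg using hall
    have hginj : Function.Injective g := fun i j hij =>
      hinj i j (g i) (hg i) (by rw [hij]; exact hg j)
    refine Set.infinite_range_of_injective hginj ((hfin _ (hpos _ hv.2)).subset ?_)
    rintro _ ⟨n, rfl⟩
    exact (hsome _ _ (hg n)).2.2 v hv (hvF n)
  · refine antitone_nat_of_succ_le fun n => ?_
    rcases h : nx (F n) with _ | v
    · have : F (n + 1) = F n := by rw [hF, h]; simp
      rw [this, h]
    · rcases h' : nx (F (n + 1)) with _ | v'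
      · exact (hpos _ (hsome _ _ h).1.2).le
      · have h2 := hsome _ _ h'
        exact (hsome _ _ h).2.2 v' h2.1 fun hv => h2.2.1 (hmono (Nat.le_succ n) hv)

/-- `decay_{γ,σ}`. Lists as in `IsDecreasingList` differ only in the order of sets of equal weight,
so the condition does not depend on the list `u`. The list is indexed from `0`, hence `j + 1`. -/
def decay (γ : Finset ℕ+ → ℝ) (C₀ : ℝ) (σ : ℕ) : EReal :=
  sSup ((fun q : ℝ => (q : EReal)) '' {q | ∀ u : ℕ → Option (Finset ℕ+),
    IsDecreasingList (cutOff γ σ) (hatWeights C₀ (cutOff γ σ)) u →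
    Tendsto (fun j : ℕ => (u j).elim 0 (hatWeights C₀ (cutOff γ σ)) * ((j : ℝ) + 1) ^ q)
      atTop (𝓝 0)})

/-- `t*_σ`: the infimum of all `t ≥ 0` such that every finite set `v` contains at most `C |v|^t`
of the nonempty sets of positive weight `γ^{(σ)}`. -/
def tStar (γ : Finset ℕ+ → ℝ) (σ : ℕ) : ℝ≥0∞ :=
  sInf (ENNReal.ofReal '' {t | 0 ≤ t ∧ ∃ C : ℝ, 0 < C ∧ ∀ v : Finset ℕ+,
    ({u : Finset ℕ+ | u.Nonempty ∧ 0 < cutOff γ σ u ∧ u ⊆ v}.ncard : ℝ) ≤ C * (v.card : ℝ) ^ t})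

end InfInt

end

/-! The lower bound rests on a fooling function. Let `m` be the kernel mean `∫ k(·, y) ρ(dy)`
divided by `√C₀`: it lies in the unit ball of `H(k)`, has integral `√C₀`, and vanishes at the anchor
`a` because `k a a = 0`. For a finite family `F` put `W = ∑ γ_u C₀^|u|` over `F`. The combination of
the tensor powers `m^{⊗u}` with coefficients `γ_u √C₀^|u| / √W` lies in `B_γ` and has integral `√W`.
If no `u ∈ F` is contained in a sampled coordinate set `v_i`, it vanishes at every sample point, so
the algorithm cannot tell it from its negative, and the squared error is at least `W`
(`ofReal_sum_le_error_sq`).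

The rest is counting. If each `v` contains at most `C |v|^t` active sets and the total cost is `N`,
then the `v_i` cover only `O(N^τ)` active sets, `τ = max 1 (t / s)` (`card_le_of_sum_cost_le`).
Hence, once `L` is twice that bound, at least half of the `L` heaviest sets are uncovered, and `L /
2` times the weight at index `L` is at most `ε²` (`IsDecreasingList.elim_mul_le`). With `N =
O(ε^{-q})` this becomes a weight bound of order `L^{-(1 + 2/(qτ))}`, so the decay is at least `1 +
2/(qτ)` (`le_decay_of_polyBound`).

The exponent `t = σ` is always admissible, which gives decay above `1` under tractability. Solving
for `q` and letting `t` approach its infimum gives the second term of the maximum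
(`two_mul_min_div_le`). The term `2/α` comes from the embedding `f ↦ f(x₁)` of the univariate
problem (`exists_univariate_algorithm`). -/

namespace InfInt

/-! ### Unit balls of `H(K)` through positive semidefinite kernels -/

section ReproducingKernel

open scoped InnerProductSpace

variable {X : Type*} {K : X → X → ℝ}

/-- The kernel section `K(·, x)` as an element of `H(K)`. -/
noncomputable def kernelSection [Fact (opKernel K).PosSemidef] (x : X) :
    RKHS.OfKernel (opKernel K) :=
  RKHS.kerFun (RKHS.OfKernel (opKernel K)) x (1 : ℝ)

theorem inner_kernelSection [Fact (opKernel K).PosSemidef] (g : RKHS.OfKernel (opKernel K))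
    (x : X) : ⟪g, kernelSection x⟫_ℝ = g x := by
  simp [kernelSection]

theorem kernelSection_apply [Fact (opKernel K).PosSemidef] (x y : X) :
    (kernelSection y : RKHS.OfKernel (opKernel K)) x = K x y := by
  rw [kernelSection, RKHS.kerFun_apply, RKHS.OfKernel.kernel_ofKernel]
  simp [opKernel]

theorem kernel_symm [Fact (opKernel K).PosSemidef] (x y : X) : K x y = K y x := by
  rw [← kernelSection_apply (K := K), ← kernelSection_apply (K := K), ← inner_kernelSection,
    real_inner_comm, inner_kernelSection]

/-- The combination of kernel sections with the given coefficients. -/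
noncomputable def sectionSum [Fact (opKernel K).PosSemidef] : (X →₀ ℝ) →ₗ[ℝ] RKHS.OfKernel (opKernel K) :=
  Finsupp.linearCombination ℝ kernelSection

theorem inner_sectionSum [Fact (opKernel K).PosSemidef] (g : RKHS.OfKernel (opKernel K))
    (c : X →₀ ℝ) : ⟪g, sectionSum c⟫_ℝ = c.sum fun x cx => cx * g x := by
  rw [sectionSum, Finsupp.linearCombination_apply, Finsupp.sum, inner_sum]
  simp only [inner_smul_right, inner_kernelSection, Finsupp.sum]

theorem norm_sectionSum_sq [Fact (opKernel K).PosSemidef] (c : X →₀ ℝ) :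
    ‖(sectionSum c : RKHS.OfKernel (opKernel K))‖ ^ 2 =
      c.sum fun x cx => c.sum fun y cy => cx * K x y * cy := by
  rw [← real_inner_self_eq_norm_sq, inner_sectionSum]
  refine Finsupp.sum_congr fun x _ => ?_
  rw [← inner_kernelSection, real_inner_comm, inner_sectionSum, Finsupp.mul_sum]
  refine Finsupp.sum_congr fun y _ => ?_
  rw [kernelSection_apply, kernel_symm (K := K) x y]
  ring

theorem posSemidef_of_opKernel (hK : (opKernel K).PosSemidef) : (Matrix.of K).PosSemidef := by
  have : Fact (opKernel K).PosSemidef := ⟨hK⟩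
  refine ⟨?_, fun c => ?_⟩
  · ext x y
    simp only [Matrix.conjTranspose_apply, Matrix.of_apply, star_trivial]
    exact kernel_symm y x
  · simpa only [star_trivial, Matrix.of_apply, ← norm_sectionSum_sq] using sq_nonneg _

/-- Turns positive semidefiniteness of `K - f ⊗ f` into the bound of `(∑ c_x f(x))²` by the
quadratic form of `K`. -/
theorem finsuppSum_sub_mul (f : X → ℝ) (c : X →₀ ℝ) :
    (c.sum fun x cx => c.sum fun y cy => cx * (K x y - f x * f y) * cy) =
      (c.sum fun x cx => c.sum fun y cy => cx * K x y * cy) -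
        (c.sum fun x cx => cx * f x) ^ 2 := by
  simp only [Finsupp.sum, sq, Finset.sum_mul_sum, ← Finset.sum_sub_distrib]
  exact Finset.sum_congr rfl fun x _ => Finset.sum_congr rfl fun y _ => by ring

/-- A function belongs to the unit ball of `H(K)` iff `K - f ⊗ f` is positive semidefinite. -/
theorem mem_kernelBall_iff (hK : (Matrix.of K).PosSemidef) {f : X → ℝ} :
    f ∈ kernelBall K ↔ (Matrix.of fun x y => K x y - f x * f y).PosSemidef := by
  constructor
  · rintro ⟨hK', g, hg, rfl⟩
    have : Fact (opKernel K).PosSemidef := ⟨hK'⟩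
    refine ⟨?_, fun c => ?_⟩
    · ext x y
      have h := hK.isHermitian.apply x y
      simp only [Matrix.of_apply, star_trivial] at h
      simp [h, mul_comm]
    · simp only [star_trivial, Matrix.of_apply]
      rw [finsuppSum_sub_mul, ← norm_sectionSum_sq, ← inner_sectionSum, sub_nonneg, ← sq_abs]
      refine pow_le_pow_left₀ (abs_nonneg _) ((abs_real_inner_le_norm _ _).trans ?_) 2
      exact mul_le_of_le_one_left (norm_nonneg _) hg
  · intro h
    have hF : Fact (opKernel K).PosSemidef := ⟨posSemidef_opKernel hK⟩
    let H := RKHS.OfKernel (opKernel K)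
    let L : (X →₀ ℝ) →ₗ[ℝ] H := sectionSum
    let φ : (X →₀ ℝ) →ₗ[ℝ] ℝ := Finsupp.linearCombination ℝ f
    have hφ : ∀ c, φ c = c.sum fun x cx => cx * f x := fun c => by
      simp [φ, Finsupp.linearCombination_apply]
    have hle : ∀ c, |φ c| ≤ ‖L c‖ := by
      intro c
      have h1 := h.2 c
      simp only [star_trivial, Matrix.of_apply] at h1
      rw [finsuppSum_sub_mul, ← norm_sectionSum_sq, ← hφ, sub_nonneg] at h1
      exact abs_le_of_sq_le_sq h1 (norm_nonneg _)
    -- By `hle`, `φ` vanishes on the kernel of `L`, so it factors through `L`. The factor is bounded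
    -- by `1` on the range of `L`; Hahn–Banach extends it to `H`, and its Riesz representer is the
    -- required element.
    have hker : φ ∈ LinearMap.range L.dualMap := by
      rw [LinearMap.range_dualMap_eq_dualAnnihilator_ker, Submodule.mem_dualAnnihilator]
      intro c hc
      have h1 := hle c
      rw [LinearMap.mem_ker.mp hc, norm_zero] at h1
      exact abs_nonpos_iff.mp h1
    obtain ⟨ψ, hψ⟩ := hker
    have hψ' : ∀ c, ψ (L c) = φ c := fun c => by rw [← hψ]; rfl
    let p : Submodule ℝ H := LinearMap.range L
    let ψ₀ : p →L[ℝ] ℝ := (ψ.comp p.subtype).mkContinuous 1 (by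
      rintro ⟨_, c, rfl⟩
      simpa [hψ'] using hle c)
    obtain ⟨Ψ, hΨ, hnorm⟩ := exists_extension_norm_eq p ψ₀
    have hψ₀ : ‖ψ₀‖ ≤ 1 := LinearMap.mkContinuous_norm_le _ zero_le_one _
    refine ⟨hF.out, (InnerProductSpace.toDual ℝ H).symm Ψ, ?_, ?_⟩
    · rw [LinearIsometryEquiv.norm_map, hnorm]; exact hψ₀
    · ext x
      rw [← inner_kernelSection, InnerProductSpace.toDual_symm_apply]
      have h1 : kernelSection x = L (Finsupp.single x 1) := by simp [L, sectionSum]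
      have h2 := hΨ ⟨L (Finsupp.single x 1), LinearMap.mem_range_self _ _⟩
      rw [h1]
      refine h2.trans ?_
      change ψ (L _) = _
      rw [hψ', hφ]
      simp

theorem kernelBall_subset_kernelSpace : kernelBall K ⊆ kernelSpace K := by
  rintro f ⟨hK, g, -, hg⟩
  exact ⟨hK, g, hg⟩

theorem smul_mem_kernelSpace {f : X → ℝ} (hf : f ∈ kernelSpace K) (c : ℝ) :
    c • f ∈ kernelSpace K := by
  obtain ⟨hK, g, rfl⟩ := hf
  have : Fact (opKernel K).PosSemidef := ⟨hK⟩
  exact ⟨hK, c • g, RKHS.coe_smul g c⟩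

theorem zero_mem_kernelBall (hK : (Matrix.of K).PosSemidef) : (0 : X → ℝ) ∈ kernelBall K := by
  rw [mem_kernelBall_iff hK]
  simpa using hK

theorem neg_mem_kernelBall {f : X → ℝ} (hf : f ∈ kernelBall K) : -f ∈ kernelBall K := by
  obtain ⟨hK, g, hg, rfl⟩ := hf
  have : Fact (opKernel K).PosSemidef := ⟨hK⟩
  exact ⟨hK, -g, by rwa [norm_neg], RKHS.coe_neg g⟩

theorem exists_smul_mem_kernelBall {f : X → ℝ} (hf : f ∈ kernelSpace K) :
    ∃ r : ℝ, ∃ g ∈ kernelBall K, f = r • g := by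
  obtain ⟨hK, g, rfl⟩ := hf
  have : Fact (opKernel K).PosSemidef := ⟨hK⟩
  have h : 0 < ‖g‖ + 1 := by positivity
  refine ⟨‖g‖ + 1, _, ⟨hK, (‖g‖ + 1)⁻¹ • g, ?_, rfl⟩, ?_⟩
  · rw [norm_smul, norm_inv, Real.norm_of_nonneg h.le, inv_mul_le_iff₀ h]
    linarith
  · rw [RKHS.coe_smul, smul_smul, mul_inv_cancel₀ h.ne', one_smul]

theorem sq_apply_le_of_mem_kernelBall (hK : (Matrix.of K).PosSemidef) {f : X → ℝ}
    (hf : f ∈ kernelBall K) (x : X) : f x ^ 2 ≤ K x x := by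
  have h := ((mem_kernelBall_iff hK).mp hf).diag_nonneg (i := x)
  simp only [Matrix.of_apply] at h
  linarith [sq (f x)]

/-- Applied at the anchor: the tensor factors of the test function vanish there. -/
theorem apply_eq_zero_of_mem_kernelSpace {f : X → ℝ} (hf : f ∈ kernelSpace K) {x : X}
    (hx : K x x = 0) : f x = 0 := by
  obtain ⟨r, g, hg, rfl⟩ := exists_smul_mem_kernelBall hf
  obtain ⟨hK, -⟩ := hf
  have h := sq_apply_le_of_mem_kernelBall (posSemidef_of_opKernel hK) hg x
  rw [hx] at h
  have : g x = 0 := by nlinarith [sq_nonneg (g x)]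
  simp [this]

theorem posSemidef_sq_le (hK : (Matrix.of K).PosSemidef) (x y : X) :
    K x y ^ 2 ≤ K x x * K y y := by
  have h := (hK.submatrix ![x, y]).det_nonneg
  have h1 := hK.isHermitian.apply x y
  simp only [Matrix.of_apply, star_trivial] at h1
  rw [Matrix.det_fin_two] at h
  simp only [Matrix.submatrix_apply, Matrix.of_apply, Matrix.cons_val_zero, Matrix.cons_val_one,
    h1] at h
  linarith [sq (K x y)]

/-- Finite combinations of kernel sections are dense, and norm convergence implies pointwise
convergence, so every element is a pointwise limit of a sequence of measurable functions. -/
theorem measurable_of_mem_kernelSpace [MeasurableSpace X] (hKm : ∀ y, Measurable fun x => K x y)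
    {f : X → ℝ} (hf : f ∈ kernelSpace K) : Measurable f := by
  obtain ⟨hK, g, rfl⟩ := hf
  have : Fact (opKernel K).PosSemidef := ⟨hK⟩
  let H := RKHS.OfKernel (opKernel K)
  have hg : g ∈ closure
      (Submodule.span ℝ {RKHS.kerFun H x v | (x : X) (v : ℝ)} : Set H) := by
    rw [← Submodule.topologicalClosure_coe, RKHS.kerFun_dense]
    trivial
  obtain ⟨F, hF, hlim⟩ := mem_closure_iff_seq_limit.mp hg
  have hmeas : ∀ e ∈ Submodule.span ℝ {RKHS.kerFun H x v | (x : X) (v : ℝ)},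
      Measurable (e : X → ℝ) := by
    intro e he
    induction he using Submodule.span_induction with
    | mem e he =>
      obtain ⟨y, v, rfl⟩ := he
      have : (RKHS.kerFun H y v : X → ℝ) = fun x => K x y * v := by
        ext x
        rw [RKHS.kerFun_apply, RKHS.OfKernel.kernel_ofKernel]
        simp [opKernel]
      rw [this]
      exact (hKm y).mul_const v
    | zero => rw [RKHS.coe_zero]; exact measurable_zero
    | add e e' _ _ h h' => rw [RKHS.coe_add]; exact h.add h'
    | smul c e _ h => rw [RKHS.coe_smul]; exact h.const_smul c
  refine measurable_of_tendsto_metrizable (fun n => hmeas _ (hF n)) ?_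
  rw [tendsto_pi_nhds]
  intro x
  exact ((RKHS.continuous_eval x).tendsto g).comp hlim

end ReproducingKernel

/-! ### The representer of integration -/

section MeanEmbedding

open scoped InnerProductSpace

variable {X : Type*} [MeasurableSpace X] {K : X → X → ℝ} {ρ : Measure X}

theorem abs_apply_le_of_kernel_diag {X : Type*} {K : X → X → ℝ} [Fact (opKernel K).PosSemidef]
    (g : RKHS.OfKernel (opKernel K)) (x : X) : |g x| ≤ ‖g‖ * √(K x x) := by
  have h := RKHS.norm_apply_le g x
  have hK : 0 ≤ K x x :=
    (posSemidef_of_opKernel (Fact.out : (opKernel K).PosSemidef)).diag_nonneg (i := x)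
  have h1 : ‖opKernel K x x‖ = K x x := by
    simp [opKernel, norm_smul, abs_of_nonneg hK]
  rwa [RKHS.OfKernel.kernel_ofKernel, h1, Real.norm_eq_abs] at h

theorem memLp_of_mem_kernelSpace (hKm : ∀ y, Measurable fun x => K x y)
    (hM : Integrable (fun x => K x x) ρ) {f : X → ℝ} (hf : f ∈ kernelSpace K) : MemLp f 2 ρ := by
  obtain ⟨r, g, hg, rfl⟩ := exists_smul_mem_kernelBall hf
  have hm := measurable_of_mem_kernelSpace hKm (kernelBall_subset_kernelSpace hg)
  refine MemLp.const_smul ?_ r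
  rw [memLp_two_iff_integrable_sq hm.aestronglyMeasurable]
  obtain ⟨hK, -⟩ := hf
  refine hM.mono' (hm.pow_const 2).aestronglyMeasurable (Eventually.of_forall fun x => ?_)
  rw [Real.norm_of_nonneg (sq_nonneg _)]
  exact sq_apply_le_of_mem_kernelBall (posSemidef_of_opKernel hK) hg x

/-- The kernel mean `m = ∫ K(·, y) ρ(dy)` represents integration on `H(K)`; its squared norm is
`∬ K dρ dρ`. -/
theorem mean_div_sqrt_mem_kernelBall [IsProbabilityMeasure ρ] (hK : (Matrix.of K).PosSemidef)
    (hKm : ∀ y, Measurable fun x => K x y) (hM : Integrable (fun x => K x x) ρ)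
    {C : ℝ} (hC : C = ∫ x, ∫ y, K x y ∂ρ ∂ρ) (hC0 : 0 < C) :
    (fun x => (√C)⁻¹ * ∫ y, K x y ∂ρ) ∈ kernelBall K := by
  have hF : Fact (opKernel K).PosSemidef := ⟨posSemidef_opKernel hK⟩
  let H := RKHS.OfKernel (opKernel K)
  have hint : ∀ g : H, Integrable (g : X → ℝ) ρ := fun g =>
    (memLp_of_mem_kernelSpace hKm hM ⟨hF.out, g, rfl⟩).integrable (by norm_num)
  have hsqrt : Integrable (fun x => √(K x x)) ρ := by
    have : MemLp (fun x => √(K x x)) 2 ρ := by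
      rw [memLp_two_iff_integrable_sq
        (Real.continuous_sqrt.comp_aestronglyMeasurable hM.aestronglyMeasurable)]
      refine hM.congr (Eventually.of_forall fun x => ?_)
      exact (Real.sq_sqrt (hK.diag_nonneg (i := x))).symm
    exact this.integrable (by norm_num)
  let Φ : H →ₗ[ℝ] ℝ :=
    { toFun := fun g => ∫ x, g x ∂ρ
      map_add' := fun g g' => by
        simp only [RKHS.coe_add, Pi.add_apply]
        exact integral_add (hint g) (hint g')
      map_smul' := fun c g => by
        simp only [RKHS.coe_smul, Pi.smul_apply, smul_eq_mul, RingHom.id_apply]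
        exact integral_const_mul _ _ }
  -- Integration is bounded because `|g x| ≤ ‖g‖ √(K x x)`. Pairing its Riesz representer `m` with a
  -- kernel section identifies `m` pointwise; pairing it with itself gives `‖m‖² = C`.
  let Ψ : H →L[ℝ] ℝ := Φ.mkContinuous (∫ x, √(K x x) ∂ρ) fun g => by
    refine (abs_integral_le_integral_abs).trans ?_
    rw [mul_comm, ← integral_const_mul]
    exact integral_mono (hint g).abs (hsqrt.const_mul _) fun x => abs_apply_le_of_kernel_diag g x
  let m : H := (InnerProductSpace.toDual ℝ H).symm Ψ
  have hm : ∀ g : H, ⟪m, g⟫_ℝ = ∫ x, g x ∂ρ := fun g =>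
    InnerProductSpace.toDual_symm_apply
  have hmx : ∀ x, m x = ∫ y, K x y ∂ρ := by
    intro x
    rw [← inner_kernelSection, hm]
    refine integral_congr_ae (Eventually.of_forall fun y => ?_)
    have := hK.isHermitian.apply x y
    simp only [Matrix.of_apply, star_trivial] at this
    change (kernelSection x : H) y = _
    rw [kernelSection_apply, this]
  have hnorm : ‖m‖ = √C := by
    rw [norm_eq_sqrt_real_inner, hm, hC]
    simp_rw [hmx]
  refine ⟨hF.out, (√C)⁻¹ • m, ?_, ?_⟩
  · have : 0 < √C := Real.sqrt_pos.mpr hC0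
    rw [norm_smul, hnorm, Real.norm_of_nonneg (by positivity), inv_mul_cancel₀ this.ne']
  · ext x
    simp [hmx]

end MeanEmbedding

/-! ### Elements of the unit ball of `H(K_γ)` -/

section WeightedKernel

variable {D : Set ℝ} {k : D → D → ℝ} {γ : Finset ℕ+ → ℝ}

theorem summable_weightedKernel (hk : (Matrix.of k).PosSemidef) (hγ : ∀ u, 0 ≤ γ u)
    (x y : domain k γ) : Summable fun u : Finset ℕ+ => γ u * prodKernel k u x y := by
  refine Summable.of_norm_bounded (x.2.add y.2) fun u => ?_
  have hu := posSemidef_prodKernel hk u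
  have h1 : 0 ≤ prodKernel k u x x := hu.diag_nonneg (i := (x : ℕ+ → D))
  have h2 : 0 ≤ prodKernel k u y y := hu.diag_nonneg (i := (y : ℕ+ → D))
  rw [Real.norm_eq_abs, abs_mul, abs_of_nonneg (hγ u), ← mul_add]
  refine mul_le_mul_of_nonneg_left (abs_le_of_sq_le_sq ?_ (add_nonneg h1 h2)) (hγ u)
  refine (posSemidef_sq_le hu _ _).trans ?_
  nlinarith [mul_nonneg h1 h2, sq_nonneg (prodKernel k u x x), sq_nonneg (prodKernel k u y y)]

/-- Removing finitely many summands from `K_γ` leaves a positive semidefinite kernel. -/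
theorem posSemidef_weightedKernel_sub_sum (hk : (Matrix.of k).PosSemidef) (hγ : ∀ u, 0 ≤ γ u)
    (F : Finset (Finset ℕ+)) :
    (Matrix.of fun x y : domain k γ =>
      weightedKernel k γ x y - ∑ u ∈ F, γ u * prodKernel k u x y).PosSemidef := by
  classical
  -- The remainder is again a weighted kernel, with the weights on `F` set to `0`, restricted from
  -- its possibly larger domain.
  let γ' : Finset ℕ+ → ℝ := fun u => if u ∈ F then 0 else γ u
  have hγ' : ∀ u, 0 ≤ γ' u := fun u => by
    by_cases h : u ∈ F <;> simp [γ', h, hγ u]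
  have hle : ∀ u, γ' u ≤ γ u := fun u => by
    by_cases h : u ∈ F <;> simp [γ', h, hγ u]
  have hsub : ∀ x : domain k γ, (x : ℕ+ → D) ∈ domain k γ' := fun x => by
    refine Summable.of_nonneg_of_le (fun u => ?_) (fun u => ?_) x.2
    · exact mul_nonneg (hγ' u) ((posSemidef_prodKernel hk u).diag_nonneg (i := (x : ℕ+ → D)))
    · exact mul_le_mul_of_nonneg_right (hle u)
        ((posSemidef_prodKernel hk u).diag_nonneg (i := (x : ℕ+ → D)))
  have h := (posSemidef_weightedKernel hk hγ').submatrix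
    fun x : domain k γ => (⟨x, hsub x⟩ : domain k γ')
  convert! h using 1
  ext x y
  simp only [Matrix.of_apply, Matrix.submatrix_apply, weightedKernel]
  have h1 := (summable_weightedKernel hk hγ x y).sum_add_tsum_compl (s := F)
  rw [← h1, add_sub_cancel_left, tsum_subtype (F : Set (Finset ℕ+))ᶜ
    fun u => γ u * prodKernel k u x y]
  refine tsum_congr fun u => ?_
  by_cases hu : u ∈ F <;> simp [γ', hu]

theorem posSemidef_mul_self {X : Type*} (f : X → ℝ) :
    (Matrix.of fun x y => f x * f y).PosSemidef := by
  refine ⟨by ext; simp [mul_comm], fun c => ?_⟩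
  have : (c.sum fun x cx => c.sum fun y cy => star cx * Matrix.of (fun x y => f x * f y) x y * cy)
      = (c.sum fun x cx => cx * f x) * (c.sum fun x cx => cx * f x) := by
    simp only [Finsupp.sum, star_trivial, Matrix.of_apply, Finset.sum_mul_sum]
    exact Finset.sum_congr rfl fun x _ => Finset.sum_congr rfl fun y _ => by ring
  rw [this]
  exact mul_self_nonneg _

/-- Tensor products of functions in the unit ball of `H(k)` lie in the unit ball of `H(k_u)`. -/
theorem posSemidef_prodKernel_sub_mul {n : D → ℝ} (hk : (Matrix.of k).PosSemidef)
    (hn : (Matrix.of fun x y => k x y - n x * n y).PosSemidef) (u : Finset ℕ+) :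
    (Matrix.of fun x y : ℕ+ → D =>
      prodKernel k u x y - (∏ j ∈ u, n (x j)) * ∏ j ∈ u, n (y j)).PosSemidef := by
  classical
  induction u using Finset.induction_on with
  | empty =>
    convert! Matrix.PosSemidef.zero using 1
    ext x y
    simp [prodKernel]
  | insert j u hj ih =>
    -- Telescoping: with `p` the tensor product over `u`, `k · k_u - (n ⊗ n)(p ⊗ p) = k · (k_u - p ⊗
    -- p) + (k - n ⊗ n)(p ⊗ p)`, and both summands are Schur products of positive semidefinite
    -- kernels.
    have h1 := (hk.submatrix (fun x : ℕ+ → D => x j)).hadamard (𝕜 := ℝ) ih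
    have h2 := (hn.submatrix (fun x : ℕ+ → D => x j)).hadamard (𝕜 := ℝ)
      (posSemidef_mul_self fun x : ℕ+ → D => ∏ j ∈ u, n (x j))
    convert! h1.add h2 using 1
    ext x y
    simp [prodKernel, Finset.prod_insert hj]
    ring

/-- The normalized sum of the tensor products of `n`, where `n` has norm at most `1` in `H(k)`. -/
noncomputable def testFunction (γ : Finset ℕ+ → ℝ) (n : D → ℝ) (C : ℝ) (F : Finset (Finset ℕ+))
    (x : ℕ+ → D) : ℝ :=
  (√(∑ u ∈ F, γ u * C ^ u.card))⁻¹ * ∑ u ∈ F, γ u * √C ^ u.card * ∏ j ∈ u, n (x j)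

/-- Write `p_u` for the tensor product of `n` and `T` for the test function. Then `K_γ - T ⊗ T`
splits into three positive semidefinite parts: `K_γ` minus its summands in `F`, the sum of `γ_u (k_u
- p_u ⊗ p_u)`, and `∑ γ_u p_u ⊗ p_u - T ⊗ T`. The last one is the weighted Cauchy–Schwarz
inequality, with `√W` as the matching normalization. -/
theorem testFunction_mem_kernelBall {n : D → ℝ} {C : ℝ} (hC : 0 ≤ C)
    (hk : (Matrix.of k).PosSemidef) (hγ : ∀ u, 0 ≤ γ u)
    (hn : (Matrix.of fun x y => k x y - n x * n y).PosSemidef) (F : Finset (Finset ℕ+))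
    (hW : 0 < ∑ u ∈ F, γ u * C ^ u.card) :
    (fun x : domain k γ => testFunction γ n C F x) ∈ kernelBall (weightedKernel k γ) := by
  rw [mem_kernelBall_iff (posSemidef_weightedKernel hk hγ)]
  set W := ∑ u ∈ F, γ u * C ^ u.card with hWdef
  let p : Finset ℕ+ → domain k γ → ℝ := fun u x => ∏ j ∈ u, n ((x : ℕ+ → D) j)
  have h1 := posSemidef_weightedKernel_sub_sum hk hγ F
  have h2 : (Matrix.of fun x y : domain k γ =>
      ∑ u ∈ F, γ u * (prodKernel k u x y - p u x * p u y)).PosSemidef := by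
    have h := Matrix.posSemidef_sum (R := ℝ) F
      (x := fun u => γ u • ((Matrix.of fun x y : ℕ+ → D =>
        prodKernel k u x y - (∏ j ∈ u, n (x j)) * ∏ j ∈ u, n (y j)).submatrix
          (Subtype.val : domain k γ → ℕ+ → D) Subtype.val))
      fun u _ => ((posSemidef_prodKernel_sub_mul hk hn u).submatrix _).smul (hγ u)
    convert! h using 1
    ext x y
    simp [Matrix.sum_apply, p]
  have h3 : (Matrix.of fun x y : domain k γ => (∑ u ∈ F, γ u * (p u x * p u y)) -
      testFunction γ n C F x * testFunction γ n C F y).PosSemidef := by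
    refine ⟨by ext; simp [mul_comm], fun c => ?_⟩
    simp only [star_trivial, Matrix.of_apply]
    rw [finsuppSum_sub_mul, sub_nonneg]
    let A : Finset ℕ+ → ℝ := fun u => c.sum fun x cx => cx * p u x
    have e1 : (c.sum fun x cx => c.sum fun y cy => cx * (∑ u ∈ F, γ u * (p u x * p u y)) * cy) =
        ∑ u ∈ F, γ u * A u ^ 2 := by
      simp only [A, Finsupp.sum, sq, Finset.mul_sum, Finset.sum_mul]
      refine (Finset.sum_congr rfl fun _ _ => Finset.sum_comm).trans (Finset.sum_comm.trans ?_)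
      exact Finset.sum_congr rfl fun u _ => Finset.sum_congr rfl fun x _ =>
        Finset.sum_congr rfl fun y _ => by ring
    have e2 : (c.sum fun x cx => cx * testFunction γ n C F x) =
        (√W)⁻¹ * ∑ u ∈ F, γ u * √C ^ u.card * A u := by
      simp only [A, Finsupp.sum, testFunction, Finset.mul_sum]
      rw [Finset.sum_comm]
      exact Finset.sum_congr rfl fun u _ => Finset.sum_congr rfl fun x _ => by
        simp only [p, ← hWdef]; ring
    rw [e1, e2, mul_pow, inv_pow, Real.sq_sqrt hW.le, inv_mul_le_iff₀ hW]
    refine Finset.sum_sq_le_sum_mul_sum_of_sq_le_mul F (fun u _ => ?_) (fun u _ => ?_)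
      fun u _ => ?_
    · exact mul_nonneg (hγ u) (pow_nonneg hC _)
    · exact mul_nonneg (hγ u) (sq_nonneg _)
    · refine le_of_eq ?_
      rw [mul_pow, mul_pow, ← pow_mul, mul_comm u.card, pow_mul, Real.sq_sqrt hC]
      ring
  convert! (h1.add h2).add h3 using 1
  ext x y
  simp only [Matrix.of_apply, Matrix.add_apply, mul_sub, Finset.sum_sub_distrib]
  ring

/-- The kernel `γ_{1} k(x₁, y₁)` is the summand `u = {1}` of `K_γ`, and the other summands only add
a positive semidefinite part. -/
theorem lift_mem_kernelBall (hk : (Matrix.of k).PosSemidef) (hγ : ∀ u, 0 ≤ γ u) {f : D → ℝ}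
    (hf : f ∈ kernelBall fun x y => γ {1} * k x y) :
    (fun x : domain k γ => f ((x : ℕ+ → D) 1)) ∈ kernelBall (weightedKernel k γ) := by
  rw [mem_kernelBall_iff (posSemidef_weightedKernel hk hγ)]
  have hk1 : (Matrix.of fun x y => γ {1} * k x y).PosSemidef := hk.smul (hγ {1})
  rw [mem_kernelBall_iff hk1] at hf
  have h1 := posSemidef_weightedKernel_sub_sum hk hγ {{1}}
  convert! h1.add (hf.submatrix fun x : domain k γ => (x : ℕ+ → D) 1) using 1
  ext x y
  simp [prodKernel]

theorem lift_mem_kernelSpace (hk : (Matrix.of k).PosSemidef) (hγ : ∀ u, 0 ≤ γ u) {f : D → ℝ}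
    (hf : f ∈ kernelSpace fun x y => γ {1} * k x y) :
    (fun x : domain k γ => f ((x : ℕ+ → D) 1)) ∈ kernelSpace (weightedKernel k γ) := by
  obtain ⟨r, g, hg, rfl⟩ := exists_smul_mem_kernelBall hf
  exact smul_mem_kernelSpace (kernelBall_subset_kernelSpace (lift_mem_kernelBall hk hγ hg)) r

end WeightedKernel

/-! ### Integrals over the infinite product -/

section Integration

variable {D : Set ℝ} {k : D → D → ℝ} {γ : Finset ℕ+ → ℝ} {ρ : Measure D}
  [IsProbabilityMeasure ρ]

theorem integrable_prod_coord {φ : D → ℝ} (hφ : Integrable φ ρ) (u : Finset ℕ+) :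
    Integrable (fun x : ℕ+ → D => ∏ j ∈ u, φ (x j)) (Measure.infinitePi fun _ => ρ) := by
  have h : Integrable (fun y : u → D => ∏ i, φ (y i)) (Measure.pi fun _ => ρ) :=
    Integrable.fintype_prod fun _ => hφ
  rw [← Measure.infinitePi_map_restrict (μ := fun _ : ℕ+ => ρ)] at h
  have h2 := h.comp_measurable (Finset.measurable_restrict u)
  refine h2.congr (Eventually.of_forall fun x => ?_)
  exact Finset.prod_coe_sort u fun j => φ (x j)

theorem integral_prod_coord {φ : D → ℝ} (hφ : Integrable φ ρ) (u : Finset ℕ+) :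
    ∫ x : ℕ+ → D, ∏ j ∈ u, φ (x j) ∂(Measure.infinitePi fun _ => ρ) =
      (∫ x, φ x ∂ρ) ^ u.card := by
  have h : Integrable (fun y : u → D => ∏ i, φ (y i)) (Measure.pi fun _ => ρ) :=
    Integrable.fintype_prod fun _ => hφ
  have h1 := integral_restrict_infinitePi (μ := fun _ : ℕ+ => ρ) h.aestronglyMeasurable
  rw [integral_fintype_prod_eq_pow, Fintype.card_coe] at h1
  rw [← h1]
  refine integral_congr_ae (Eventually.of_forall fun x => ?_)
  exact (Finset.prod_coe_sort u fun j => φ (x j)).symm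

/-- By Tonelli, `∑ γ_u k_u(x, x)` has integral `∑ γ_u M^|u| < ∞`, so it is finite almost everywhere.
-/
theorem ae_mem_domain (hk : (Matrix.of k).PosSemidef) (hM : Integrable (fun x => k x x) ρ)
    (hγ : ∀ u, 0 ≤ γ u)
    (hsum : Summable fun u : Finset ℕ+ => γ u * (∫ x, k x x ∂ρ) ^ u.card) :
    ∀ᵐ x ∂(Measure.infinitePi fun _ : ℕ+ => ρ), x ∈ domain k γ := by
  have hnn : ∀ u (x : ℕ+ → D), 0 ≤ γ u * prodKernel k u x x := fun u x =>
    mul_nonneg (hγ u) ((posSemidef_prodKernel hk u).diag_nonneg (i := x))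
  have hint : ∀ u, Integrable (fun x : ℕ+ → D => γ u * prodKernel k u x x)
      (Measure.infinitePi fun _ => ρ) := fun u => (integrable_prod_coord hM u).const_mul _
  have hmeas : ∀ u, AEMeasurable (fun x : ℕ+ → D => ENNReal.ofReal (γ u * prodKernel k u x x))
      (Measure.infinitePi fun _ => ρ) := fun u => (hint u).aemeasurable.ennreal_ofReal
  have hval : ∀ u, ∫⁻ x, ENNReal.ofReal (γ u * prodKernel k u x x)
      ∂(Measure.infinitePi fun _ : ℕ+ => ρ) =
        ENNReal.ofReal (γ u * (∫ x, k x x ∂ρ) ^ u.card) := by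
    intro u
    rw [← ofReal_integral_eq_lintegral_ofReal (hint u) (Eventually.of_forall (hnn u)),
      integral_const_mul]
    congr 2
    exact integral_prod_coord hM u
  have hfin : ∫⁻ x, ∑' u, ENNReal.ofReal (γ u * prodKernel k u x x)
      ∂(Measure.infinitePi fun _ : ℕ+ => ρ) ≠ ⊤ := by
    rw [lintegral_tsum hmeas]
    simp_rw [hval]
    exact hsum.tsum_ofReal_ne_top
  filter_upwards [ae_lt_top' (AEMeasurable.tsum hmeas) hfin] with x hx
  have h := ENNReal.summable_toReal hx.ne
  refine h.congr fun u => ?_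
  exact (ENNReal.toReal_ofReal (hnn u x))

theorem setIntegral_extendZero {X : Type*} [MeasurableSpace X] {μ : Measure X} {S : Set X}
    (hS : ∀ᵐ x ∂μ, x ∈ S) (G : X → ℝ) :
    ∫ x in S, extendZero S (fun x : S => G x) x ∂μ = ∫ x, G x ∂μ := by
  rw [Measure.restrict_eq_self_of_ae_mem hS]
  refine integral_congr_ae ?_
  filter_upwards [hS] with x hx
  exact Subtype.val_injective.extend_apply (fun x : S => G x) 0 ⟨x, hx⟩

theorem integral_testFunction {n : D → ℝ} {C : ℝ} (hC : 0 ≤ C) (hn : Integrable n ρ)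
    (hnC : ∫ x, n x ∂ρ = √C) (F : Finset (Finset ℕ+)) :
    ∫ x, testFunction γ n C F x ∂(Measure.infinitePi fun _ : ℕ+ => ρ) =
      √(∑ u ∈ F, γ u * C ^ u.card) := by
  simp only [testFunction]
  rw [integral_const_mul, integral_finsetSum _ fun u _ =>
    (integrable_prod_coord hn u).const_mul _]
  have : ∀ u ∈ F, ∫ x, γ u * √C ^ u.card * ∏ j ∈ u, n (x j)
      ∂(Measure.infinitePi fun _ : ℕ+ => ρ) = γ u * C ^ u.card := by
    intro u _
    rw [integral_const_mul, integral_prod_coord hn, hnC, mul_assoc, ← mul_pow,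
      Real.mul_self_sqrt hC]
  rw [Finset.sum_congr rfl this, mul_comm, ← div_eq_mul_inv, Real.div_sqrt]

end Integration

/-! ### Integrands that an algorithm cannot distinguish -/

namespace AdaptiveMethod

variable {X : Type*} {A : AdaptiveMethod X} {f g : X → ℝ}

theorem history_eq_of_eq_on_nodes {n : ℕ}
    (h : ∀ i < n, ∀ x, A.node f i = some x → f x = g x) :
    ∀ i ≤ n, A.history f i = A.history g i := by
  intro i
  induction i with
  | zero => intro _; rfl
  | succ i ih =>
    intro hi
    have h1 := ih (Nat.le_of_succ_le hi)
    have h2 := h i hi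
    rw [node] at h2
    simp only [history]
    rw [← h1]
    rcases hx : A.next (A.history f i) with _ | x
    · rfl
    · simp only [h2 x hx]

/-- Two integrands that agree at all sample points lead to the same result. -/
theorem result_eq_of_eq_on_nodes {n : ℕ} (hn : A.node f n = none)
    (h : ∀ i < n, ∀ x, A.node f i = some x → f x = g x) : A.result f = A.result g := by
  classical
  have hhist := history_eq_of_eq_on_nodes h
  have hnode : ∀ i ≤ n, A.node f i = A.node g i := fun i hi => by
    rw [node, node, hhist i hi]
  have hf : ∃ i, A.node f i = none := ⟨n, hn⟩
  have hg : ∃ i, A.node g i = none := ⟨n, by rw [← hnode n le_rfl, hn]⟩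
  have hle : Nat.find hf ≤ n := Nat.find_min' hf hn
  have hfind : Nat.find hg = Nat.find hf := by
    rw [Nat.find_eq_iff]
    refine ⟨by rw [← hnode _ hle]; exact Nat.find_spec hf, fun m hm => ?_⟩
    rw [← hnode m (hm.le.trans hle)]
    exact Nat.find_min hf hm
  rw [result, result, dif_pos hf, dif_pos hg, hfind, hhist _ hle]

end AdaptiveMethod

namespace Problem

variable {X : Type*} {p : Problem X}

theorem error_sq (Q : RandomizedAlgorithm X) : p.error Q ^ 2 = ⨆ f ∈ p.ball,
    ∫⁻ ω, ENNReal.ofReal ((p.functional f - (Q.method ω).result f) ^ 2) ∂Q.P := by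
  rw [error, ← ENNReal.rpow_natCast, ← ENNReal.rpow_mul]
  norm_num

/-- An algorithm that cannot distinguish `f` from `-f` has error at least `|I(f)|`. -/
theorem ofReal_sq_functional_le_error_sq {Q : RandomizedAlgorithm X} {f : X → ℝ}
    (hf : f ∈ p.ball) (hf' : -f ∈ p.ball) (hneg : p.functional (-f) = -p.functional f)
    (hmeas : AEMeasurable (fun ω => (Q.method ω).result f) Q.P)
    (heq : ∀ᵐ ω ∂Q.P, (Q.method ω).result f = (Q.method ω).result (-f)) :
    ENNReal.ofReal (p.functional f ^ 2) ≤ p.error Q ^ 2 := by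
  set I := p.functional f with hI
  set E := p.error Q ^ 2 with hE
  have h1 : ∫⁻ ω, ENNReal.ofReal ((I - (Q.method ω).result f) ^ 2) ∂Q.P ≤ E := by
    rw [hE, error_sq]
    exact le_iSup₂_of_le f hf le_rfl
  have h2 : ∫⁻ ω, ENNReal.ofReal ((-I - (Q.method ω).result f) ^ 2) ∂Q.P ≤ E := by
    rw [hE, error_sq]
    refine le_iSup₂_of_le (-f) hf' (le_of_eq (lintegral_congr_ae ?_))
    filter_upwards [heq] with ω hω
    rw [hneg, hω]
  -- For any common output `r`, `(I - r)² + (-I - r)² = 2 I² + 2 r² ≥ 2 I²`.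
  have h3 : ENNReal.ofReal (2 * I ^ 2) ≤ E + E := by
    refine le_trans ?_ (add_le_add h1 h2)
    rw [← lintegral_add_left' ((hmeas.const_sub I).pow_const 2).ennreal_ofReal]
    calc ENNReal.ofReal (2 * I ^ 2) = ∫⁻ _, ENNReal.ofReal (2 * I ^ 2) ∂Q.P := by simp
      _ ≤ _ := lintegral_mono fun ω => by
        rw [← ENNReal.ofReal_add (sq_nonneg _) (sq_nonneg _)]
        exact ENNReal.ofReal_le_ofReal (by nlinarith [sq_nonneg ((Q.method ω).result f)])
  rw [← two_mul, ENNReal.ofReal_mul zero_le_two, ENNReal.ofReal_ofNat] at h3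
  exact (ENNReal.mul_le_mul_iff_right two_ne_zero ENNReal.ofNat_ne_top).mp h3

end Problem

/-! ### Error caused by uncovered coordinate sets -/

section LowerBound

variable {D : Set ℝ} {k : D → D → ℝ} {a : D} {ρ : Measure D}
  {γ : Finset ℕ+ → ℝ} {cst : ℕ → ℝ≥0∞}

theorem extendZero_neg {X : Type*} (S : Set X) (f : S → ℝ) :
    extendZero S (-f) = -extendZero S f := by
  ext x
  by_cases hx : x ∈ S
  · rw [Pi.neg_apply, extendZero, extendZero]
    rw [Subtype.val_injective.extend_apply (-f) 0 ⟨x, hx⟩,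
      Subtype.val_injective.extend_apply f 0 ⟨x, hx⟩, Pi.neg_apply]
  · have h : ¬∃ y : S, (y : X) = x := fun ⟨y, hy⟩ => hx (hy ▸ y.2)
    rw [Pi.neg_apply, extendZero, extendZero, Function.extend_apply' _ _ _ h,
      Function.extend_apply' _ _ _ h]
    simp

theorem extendZero_eq_zero {X : Type*} {S : Set X} {f : X → ℝ} {x : X} (hx : f x = 0) :
    extendZero S (fun y : S => f y) x = 0 := by
  by_cases hS : x ∈ S
  · exact (Subtype.val_injective.extend_apply (fun y : S => f y) 0 ⟨x, hS⟩).trans hx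
  · exact Function.extend_apply' _ _ _ fun ⟨y, hy⟩ => hS (hy ▸ y.2)

theorem ball_subset_space :
    (infProblem k a ρ γ cst).ball ⊆ (infProblem k a ρ γ cst).space :=
  Set.image_mono kernelBall_subset_kernelSpace

theorem testFunction_eq_zero {n : D → ℝ} {C : ℝ} {F : Finset (Finset ℕ+)} (hna : n a = 0)
    {v : Finset ℕ+} (hF : ∀ u ∈ F, ¬u ⊆ v) {x : ℕ+ → D} (hx : x ∈ sampleSpace a v) :
    testFunction γ n C F x = 0 := by
  refine mul_eq_zero_of_right _ (Finset.sum_eq_zero fun u hu => ?_)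
  obtain ⟨j, hj, hjv⟩ := Finset.not_subset.mp (hF u hu)
  rw [Finset.prod_eq_zero hj, mul_zero]
  rw [hx j hjv, hna]

/-- The weights of sets that are not contained in any of the sampled coordinate sets contribute
to the error. -/
theorem ofReal_sum_le_error_sq [IsProbabilityMeasure ρ] (hk : (Matrix.of k).PosSemidef)
    (hkm : Measurable (Function.uncurry k)) (ha : k a a = 0)
    (hM : Integrable (fun x => k x x) ρ) (hγ : ∀ u, 0 ≤ γ u)
    (hsum : Summable fun u : Finset ℕ+ => γ u * (∫ x, k x x ∂ρ) ^ u.card)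
    {C₀ : ℝ} (hC₀ : C₀ = ∫ x, ∫ y, k x y ∂ρ ∂ρ) (hC₀_pos : 0 < C₀)
    {Q : RandomizedAlgorithm (ℕ+ → D)} (hQ : Q ∈ (infProblem k a ρ γ cst).ran)
    {n : ℕ} {v : Fin n → Finset ℕ+}
    (hv : ∀ f ∈ (infProblem k a ρ γ cst).space, ∀ᵐ ω ∂Q.P, (Q.method ω).node f n = none ∧
      ∀ i : Fin n, ∃ x ∈ sampleSpace a (v i), (Q.method ω).node f i = some x)
    {F : Finset (Finset ℕ+)} (hF : ∀ u ∈ F, ∀ i, ¬u ⊆ v i) :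
    ENNReal.ofReal (∑ u ∈ F, γ u * C₀ ^ u.card) ≤ (infProblem k a ρ γ cst).error Q ^ 2 := by
  set p := infProblem k a ρ γ cst with hp
  -- If the total weight is `0` there is nothing to prove; otherwise the test function can be
  -- normalized.
  rcases (Finset.sum_nonneg fun u (_ : u ∈ F) =>
    mul_nonneg (hγ u) (pow_nonneg hC₀_pos.le u.card)).eq_or_lt with hW | hW
  · rw [← hW]; simp
  have hkm' : ∀ y, Measurable fun x => k x y := fun y =>
    hkm.comp (measurable_id.prodMk measurable_const)
  set m : D → ℝ := fun x => (√C₀)⁻¹ * ∫ y, k x y ∂ρ with hm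
  have hmball : m ∈ kernelBall k := mean_div_sqrt_mem_kernelBall hk hkm' hM hC₀ hC₀_pos
  have hmspace := kernelBall_subset_kernelSpace hmball
  have hma : m a = 0 := apply_eq_zero_of_mem_kernelSpace hmspace ha
  have hmint : Integrable m ρ := (memLp_of_mem_kernelSpace hkm' hM hmspace).integrable (by norm_num)
  have hmC : ∫ x, m x ∂ρ = √C₀ := by
    rw [hm, integral_const_mul, ← hC₀, mul_comm, ← div_eq_mul_inv, Real.div_sqrt]
  let T : domain k γ → ℝ := fun x => testFunction γ m C₀ F x
  have hT : T ∈ kernelBall (weightedKernel k γ) :=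
    testFunction_mem_kernelBall hC₀_pos.le hk hγ ((mem_kernelBall_iff hk).mp hmball) F hW
  let G := extendZero (domain k γ) T
  have hG : G ∈ p.ball := ⟨T, hT, rfl⟩
  have hG' : -G ∈ p.ball := ⟨-T, neg_mem_kernelBall hT, extendZero_neg _ _⟩
  have hI : p.functional G = √(∑ u ∈ F, γ u * C₀ ^ u.card) := by
    rw [← integral_testFunction hC₀_pos.le hmint hmC F]
    exact setIntegral_extendZero (ae_mem_domain hk hM hγ hsum) _
  have hneg : p.functional (-G) = -p.functional G := integral_neg _
  have key := p.ofReal_sq_functional_le_error_sq hG hG' hneg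
    (hQ G (ball_subset_space hG)).1.aestronglyMeasurable.aemeasurable ?_
  · rwa [hI, Real.sq_sqrt hW.le] at key
  filter_upwards [hv G (ball_subset_space hG)] with ω hω
  refine AdaptiveMethod.result_eq_of_eq_on_nodes hω.1 fun i hi x hx => ?_
  obtain ⟨y, hy, hyx⟩ := hω.2 ⟨i, hi⟩
  obtain rfl : y = x := by simpa [hx] using hyx.symm
  have : G y = 0 := extendZero_eq_zero (S := domain k γ)
    (testFunction_eq_zero hma (fun u hu => hF u hu ⟨i, hi⟩) hy)
  simp [this]

end LowerBound

/-! ### Counting covered sets and reading off decay -/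

section Counting

/-- Coordinate sets of total cost `N` contain at most `C (N / c) ^ max 1 (t / s)` sets from a
family with growth exponent `t`. -/
theorem card_le_of_sum_cost_le {cst : ℕ → ℝ≥0∞} (hone : ∀ ν, 1 ≤ cst ν) {s c : ℝ} (hs : 0 < s)
    (hc : 0 < c) (hc1 : c ≤ 1) (hcst : ∀ ν : ℕ, ENNReal.ofReal (c * (ν : ℝ) ^ s) ≤ cst ν)
    {S : Set (Finset ℕ+)} {t C : ℝ} (ht : 0 ≤ t) (hC : 0 < C)
    (hS : ∀ v : Finset ℕ+, ({u | u ∈ S ∧ u ⊆ v}.ncard : ℝ) ≤ C * (v.card : ℝ) ^ t)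
    {n : ℕ} {v : Fin n → Finset ℕ+} {N : ℝ} (hN : 0 ≤ N)
    (hv : ∑ i, cst (v i).card ≤ ENNReal.ofReal N) {G : Finset (Finset ℕ+)}
    (hGS : ∀ u ∈ G, u ∈ S) (hG : ∀ u ∈ G, ∃ i, u ⊆ v i) :
    (G.card : ℝ) ≤ C * (N / c) ^ max 1 (t / s) := by
  classical
  set τ := max 1 (t / s) with hτ
  have hτ1 : 1 ≤ τ := le_max_left _ _
  have hfin : ∀ i, cst (v i).card ≠ ⊤ := fun i =>
    ((Finset.single_le_sum (f := fun i => cst (v i).card) (fun _ _ => zero_le)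
      (Finset.mem_univ i)).trans hv).trans_lt ENNReal.ofReal_lt_top |>.ne
  let x : Fin n → ℝ := fun i => (cst (v i).card).toReal / c
  have hx1 : ∀ i, 1 ≤ x i := fun i => by
    have h : 1 ≤ (cst (v i).card).toReal := by
      simpa using ENNReal.toReal_mono (hfin i) (hone (v i).card)
    rw [one_le_div hc]
    exact hc1.trans h
  have hsum : ∑ i, x i ≤ N / c := by
    rw [← Finset.sum_div]
    refine div_le_div_of_nonneg_right ?_ hc.le
    rw [← ENNReal.toReal_sum fun i _ => hfin i]
    exact ENNReal.toReal_le_of_le_ofReal hN hv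
  -- Raising the exponent from `t / s` to `τ` uses `x i ≥ 1`, which is why `c ≤ 1 ≤ cst ν` is
  -- required.
  have hpow : ∀ i, ((v i).card : ℝ) ^ t ≤ x i ^ τ := fun i => by
    have h1 : ((v i).card : ℝ) ^ s ≤ x i := by
      rw [le_div_iff₀ hc, mul_comm]
      exact (ENNReal.ofReal_le_iff_le_toReal (hfin i)).mp (hcst _)
    have h0 : (0 : ℝ) ≤ ((v i).card : ℝ) ^ s := Real.rpow_nonneg (Nat.cast_nonneg _) _
    calc ((v i).card : ℝ) ^ t = (((v i).card : ℝ) ^ s) ^ (t / s) := by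
          rw [← Real.rpow_mul (Nat.cast_nonneg _), mul_div_cancel₀ _ hs.ne']
      _ ≤ x i ^ (t / s) := Real.rpow_le_rpow h0 h1 (div_nonneg ht hs.le)
      _ ≤ x i ^ τ := Real.rpow_le_rpow_of_exponent_le (hx1 i) (le_max_right _ _)
  have hcov : G ⊆ Finset.univ.biUnion fun i => G.filter (· ⊆ v i) := fun u hu => by
    obtain ⟨i, hi⟩ := hG u hu
    simp only [Finset.mem_biUnion, Finset.mem_univ, true_and, Finset.mem_filter]
    exact ⟨i, hu, hi⟩
  have hcard : ∀ i, ((G.filter (· ⊆ v i)).card : ℝ) ≤ C * x i ^ τ := fun i => by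
    refine le_trans ?_ ((hS (v i)).trans (mul_le_mul_of_nonneg_left (hpow i) hC.le))
    rw [← Set.ncard_coe_finset]
    refine Nat.cast_le.mpr (Set.ncard_le_ncard ?_ ?_)
    · intro u hu
      simp only [Finset.coe_filter, Set.mem_ofPred_eq] at hu
      exact ⟨hGS u hu.1, hu.2⟩
    · exact (v i).powerset.finite_toSet.subset fun u hu => by simpa using hu.2
  have hN' : 0 ≤ N / c := div_nonneg hN hc.le
  calc (G.card : ℝ) ≤ ∑ i, ((G.filter (· ⊆ v i)).card : ℝ) := by
        exact_mod_cast (Finset.card_le_card hcov).trans Finset.card_biUnion_le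
    _ ≤ ∑ i, C * x i ^ τ := Finset.sum_le_sum fun i _ => hcard i
    -- Superadditivity of `x ↦ x ^ τ` for `τ ≥ 1`: keep one factor `x i` and bound the other `τ - 1`
    -- powers by the total.
    _ = C * ∑ i, x i * x i ^ (τ - 1) := by
        rw [Finset.mul_sum]
        refine Finset.sum_congr rfl fun i _ => ?_
        rw [← Real.rpow_one_add' (zero_le_one.trans (hx1 i)) (by linarith)]
        congr 2
        ring
    _ ≤ C * ∑ i, x i * (N / c) ^ (τ - 1) := by
        refine mul_le_mul_of_nonneg_left (Finset.sum_le_sum fun i _ => ?_) hC.le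
        have h0 := zero_le_one.trans (hx1 i)
        refine mul_le_mul_of_nonneg_left (Real.rpow_le_rpow h0 ?_ (by linarith)) h0
        exact (Finset.single_le_sum (f := x) (fun j _ => zero_le_one.trans (hx1 j))
          (Finset.mem_univ i)).trans hsum
    _ ≤ C * (N / c) ^ τ := by
        rw [← Finset.sum_mul]
        refine mul_le_mul_of_nonneg_left ?_ hC.le
        refine (mul_le_mul_of_nonneg_right hsum (Real.rpow_nonneg hN' _)).trans_eq ?_
        rw [← Real.rpow_one_add' hN' (by linarith)]
        congr 1
        ring

/-- Every such `u` is the image of a map `Fin σ → v`; nonemptiness allows short sets to be listed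
with repetitions. -/
theorem ncard_subsets_le (σ : ℕ+) (v : Finset ℕ+) :
    ({u : Finset ℕ+ | (u.Nonempty ∧ u.card ≤ σ) ∧ u ⊆ v}.ncard : ℝ) ≤
      (v.card : ℝ) ^ ((σ : ℕ) : ℝ) := by
  classical
  rw [Real.rpow_natCast]
  let Φ : (Fin σ → v) → Finset ℕ+ := fun g => Finset.univ.image fun i => (g i : ℕ+)
  have hsub : {u : Finset ℕ+ | (u.Nonempty ∧ u.card ≤ σ) ∧ u ⊆ v} ⊆ Set.range Φ := by
    rintro u ⟨⟨⟨j, hj⟩, hcard⟩, huv⟩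
    have : Nonempty u := ⟨⟨j, hj⟩⟩
    obtain ⟨g, hg⟩ : ∃ g : Fin σ → u, Function.Surjective g := by
      have hle : Fintype.card u ≤ Fintype.card (Fin σ) := by simpa using hcard
      obtain ⟨e⟩ := Function.Embedding.nonempty_of_card_le hle
      exact ⟨Function.invFun e, Function.invFun_surjective e.injective⟩
    refine ⟨fun i => ⟨g i, huv (g i).2⟩, ?_⟩
    ext x
    simp only [Φ, Finset.mem_image, Finset.mem_univ, true_and]
    refine ⟨fun ⟨i, hi⟩ => hi ▸ (g i).2, fun hx => ?_⟩
    obtain ⟨i, hi⟩ := hg ⟨x, hx⟩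
    exact ⟨i, by rw [hi]⟩
  have h1 := (Set.ncard_le_ncard hsub (Set.finite_range Φ)).trans (Finite.card_range_le Φ)
  rw [Nat.card_eq_fintype_card] at h1
  simp only [Fintype.card_fun, Fintype.card_coe, Fintype.card_fin] at h1
  exact_mod_cast h1

/-- If the weights outside of any covered family are small, the weights in a decreasing list are
small. -/
theorem IsDecreasingList.elim_mul_le {γ w : Finset ℕ+ → ℝ} {u : ℕ → Option (Finset ℕ+)}
    (hu : IsDecreasingList γ w u) {P : Finset ℕ+ → Prop} {m E : ℝ} {L : ℕ}
    (hm : 2 * m ≤ L) (hE : 0 ≤ E)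
    (hcard : ∀ G : Finset (Finset ℕ+), (∀ x ∈ G, x.Nonempty ∧ 0 < γ x) → (∀ x ∈ G, P x) →
      (G.card : ℝ) ≤ m)
    (hsum : ∀ F : Finset (Finset ℕ+), (∀ x ∈ F, x.Nonempty ∧ 0 < γ x) → (∀ x ∈ F, ¬P x) →
      ∑ x ∈ F, w x ≤ E) :
    (u L).elim 0 w * (L / 2) ≤ E := by
  classical
  set y := (u L).elim 0 w with hy
  -- An exhausted list has `y = 0` and falls into the first case. If `y > 0`, the entries `0, …, L -
  -- 1` are `L` genuine sets, each of weight at least `y`.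
  rcases le_or_gt y 0 with hy0 | hy0
  · exact (mul_nonpos_of_nonpos_of_nonneg hy0 (by positivity)).trans hE
  have hle : ∀ j ≤ L, y ≤ (u j).elim 0 w := fun j hj => hu.anti hj
  have hsome : ∀ j : Fin L, ∃ x, u j = some x := fun j => by
    rcases h : u j with _ | x
    · have := hle j j.2.le
      rw [h] at this
      exact absurd hy0 (not_lt.mpr this)
    · exact ⟨x, rfl⟩
  choose x hx using hsome
  have hinj : Function.Injective x := fun i j hij =>
    Fin.ext (hu.inj i j (x i) (hx i) (by rw [hij]; exact hx j))
  have hxmem : ∀ j, (x j).Nonempty ∧ 0 < γ (x j) := fun j => (hu.mem_iff _).mpr ⟨j, hx j⟩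
  let A : Finset (Finset ℕ+) := Finset.univ.image x
  have hA : ∀ z ∈ A, (z.Nonempty ∧ 0 < γ z) ∧ y ≤ w z := by
    intro z hz
    obtain ⟨j, -, rfl⟩ := Finset.mem_image.mp hz
    refine ⟨hxmem j, ?_⟩
    have := hle j j.2.le
    rwa [hx j] at this
  have hAcard : A.card = L := by
    rw [Finset.card_image_of_injective _ hinj, Finset.card_univ, Fintype.card_fin]
  -- At most `m ≤ L / 2` of these sets satisfy `P`, so at least `L / 2` sets of weight at least `y`
  -- remain in the sum bounded by `E`.
  have h1 := hcard (A.filter P) (fun z hz => (hA z (Finset.mem_filter.mp hz).1).1)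
    fun z hz => (Finset.mem_filter.mp hz).2
  have h2 := hsum (A.filter fun z => ¬P z) (fun z hz => (hA z (Finset.mem_filter.mp hz).1).1)
    fun z hz => (Finset.mem_filter.mp hz).2
  have h3 : ((A.filter P).card : ℝ) + (A.filter fun z => ¬P z).card = L := by
    rw [← hAcard]
    exact_mod_cast Finset.card_filter_add_card_filter_not (s := A) P
  have h4 : ((A.filter fun z => ¬P z).card : ℝ) * y ≤ ∑ z ∈ A.filter fun z => ¬P z, w z := by
    rw [← nsmul_eq_mul]
    exact Finset.card_nsmul_le_sum _ _ _ fun z hz => (hA z (Finset.mem_filter.mp hz).1).2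
  nlinarith

/-- Every real exponent below `κ` is admissible in `decay`; the shift from `L` to `L + 1` is
harmless since `(L + 1) / L → 1`. -/
theorem le_decay_of_bound {γ : Finset ℕ+ → ℝ} (hγ : ∀ u, 0 ≤ γ u) {C₀ : ℝ} (hC₀ : 0 ≤ C₀) {σ : ℕ}
    {κ : ℝ}
    (h : ∀ u : ℕ → Option (Finset ℕ+),
      IsDecreasingList (cutOff γ σ) (hatWeights C₀ (cutOff γ σ)) u →
      ∃ B : ℝ, ∀ᶠ L : ℕ in atTop,
        (u L).elim 0 (hatWeights C₀ (cutOff γ σ)) ≤ B * (L : ℝ) ^ (-κ)) :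
    (κ : EReal) ≤ decay γ C₀ σ := by
  refine le_of_forall_lt fun z hz => ?_
  obtain ⟨y, hzy, hyκ⟩ := EReal.lt_iff_exists_real_btwn.mp hz
  refine hzy.trans_le (le_sSup ⟨y, fun u hu => ?_, rfl⟩)
  obtain ⟨B, hB⟩ := h u hu
  have hyκ' : y < κ := by exact_mod_cast hyκ
  have hw : ∀ j, 0 ≤ (u j).elim 0 (hatWeights C₀ (cutOff γ σ)) := fun j => by
    rcases u j with _ | v
    · exact le_rfl
    · refine mul_nonneg ?_ (pow_nonneg hC₀ _)
      rw [cutOff]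
      split_ifs
      exacts [hγ v, le_rfl]
  have hlim : Tendsto (fun L : ℕ => B * (L : ℝ) ^ (-κ) * ((L : ℝ) + 1) ^ y) atTop (𝓝 0) := by
    have h1 : Tendsto (fun L : ℕ => ((L : ℝ)) ^ (-(κ - y))) atTop (𝓝 0) :=
      (tendsto_rpow_neg_atTop (sub_pos.mpr hyκ')).comp tendsto_natCast_atTop_atTop
    have h2 : Tendsto (fun L : ℕ => (((L : ℝ) + 1) / L) ^ y) atTop (𝓝 (1 ^ y)) := by
      have : Tendsto (fun L : ℕ => ((L : ℝ) + 1) / L) atTop (𝓝 1) := by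
        have h3 := tendsto_one_div_atTop_nhds_zero_nat (𝕜 := ℝ)
        have h4 := h3.const_add 1
        rw [add_zero] at h4
        refine h4.congr' ?_
        filter_upwards [eventually_gt_atTop 0] with L hL
        have : (L : ℝ) ≠ 0 := by positivity
        field_simp
      exact this.rpow_const (Or.inl one_ne_zero)
    have h5 := (h1.mul h2).const_mul B
    rw [zero_mul, mul_zero] at h5
    refine h5.congr' ?_
    filter_upwards [eventually_gt_atTop 0] with L hL
    have hL' : (0 : ℝ) < L := by positivity
    rw [Real.div_rpow (by positivity) hL'.le, neg_sub, Real.rpow_sub hL', Real.rpow_neg hL'.le]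
    have : (L : ℝ) ^ y ≠ 0 := (Real.rpow_pos_of_pos hL' _).ne'
    field_simp
  refine squeeze_zero' (Eventually.of_forall fun j => ?_) ?_ hlim
  · exact mul_nonneg (hw j) (Real.rpow_nonneg (by positivity) _)
  · filter_upwards [hB] with L hL
    exact mul_le_mul_of_nonneg_right hL (Real.rpow_nonneg (by positivity) _)

end Counting

/-- The infimum in `comp` need not be attained, hence the strictly larger constant `C + 1`.
Restricting to `ε ≤ 1` permits a larger exponent, in particular a positive one when `q₀ = 0`. -/
theorem Problem.PolyBound.exists_algorithm {X : Type*} {p : Problem X}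
    {𝒜 : Set (RandomizedAlgorithm X)} {q₀ q : ℝ} (h : p.PolyBound 𝒜 q₀) (hq : q₀ ≤ q) :
    ∃ B : ℝ, 0 < B ∧ ∀ ε : ℝ, 0 < ε → ε ≤ 1 → ∃ Q ∈ 𝒜, p.error Q ≤ ENNReal.ofReal ε ∧
      p.worstCost Q ≤ ENNReal.ofReal (B * ε ^ (-q)) := by
  obtain ⟨-, C, hC, hb⟩ := h
  refine ⟨C + 1, by linarith, fun ε hε hε1 => ?_⟩
  have h1 : ENNReal.ofReal (C * ε ^ (-q₀)) < ENNReal.ofReal ((C + 1) * ε ^ (-q)) := by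
    have hpos := Real.rpow_pos_of_pos hε (-q)
    have hle : ε ^ (-q₀) ≤ ε ^ (-q) := Real.rpow_le_rpow_of_exponent_ge hε hε1 (by linarith)
    refine (ENNReal.ofReal_lt_ofReal_iff (by positivity)).mpr ?_
    nlinarith [mul_le_mul_of_nonneg_left hle hC]
  obtain ⟨c, ⟨Q, hQ, hQe, rfl⟩, hc⟩ := sInf_lt_iff.mp ((hb ε hε).trans_lt h1)
  exact ⟨Q, hQ, hQe, hc.le⟩

/-! ### From a complexity exponent to the decay of the weights -/

section DecayBound

variable {D : Set ℝ} {k : D → D → ℝ} {a : D} {ρ : Measure D}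
  {γ : Finset ℕ+ → ℝ} {cst : ℕ → ℝ≥0∞}

/-- The expected cost is the same for every integrand, so testing the worst case cost on the zero
function already yields the full sum. -/
theorem exists_of_mem_res (hk : (Matrix.of k).PosSemidef) (hγ : ∀ u, 0 ≤ γ u)
    {Q : RandomizedAlgorithm (ℕ+ → D)}
    (hQ : Q ∈ res (infProblem k a ρ γ cst) a cst) :
    Q ∈ (infProblem k a ρ γ cst).ran ∧ ∃ (n : ℕ) (v : Fin n → Finset ℕ+),
      (∀ f ∈ (infProblem k a ρ γ cst).space, ∀ᵐ ω ∂Q.P, (Q.method ω).node f n = none ∧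
        ∀ i : Fin n, ∃ x ∈ sampleSpace a (v i), (Q.method ω).node f i = some x) ∧
      ∑ i, cst (v i).card ≤ (infProblem k a ρ γ cst).worstCost Q := by
  obtain ⟨hran, n, v, hv⟩ := hQ
  refine ⟨hran, n, v, fun f hf => (hv f hf).1, ?_⟩
  have h0 : extendZero (domain k γ) 0 ∈ (infProblem k a ρ γ cst).ball :=
    ⟨0, zero_mem_kernelBall (posSemidef_weightedKernel hk hγ), rfl⟩
  rw [← (hv _ (ball_subset_space h0)).2]
  exact le_iSup₂_of_le (f := fun f (_ : f ∈ (infProblem k a ρ γ cst).ball) =>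
    ∫⁻ ω, (Q.method ω).cost f (infProblem k a ρ γ cst).cost ∂Q.P) _ h0 le_rfl

/-- Shrinking the constant makes the growth bound hold for all `ν`: the finitely many small `ν` are
covered by `cst ν ≥ 1`. -/
theorem exists_cost_lower_bound (hone : ∀ ν, 1 ≤ cst ν) {s : ℝ} (hs : 0 < s)
    (hcst : ∃ c : ℝ, 0 < c ∧ ∀ᶠ ν : ℕ in atTop, ENNReal.ofReal (c * (ν : ℝ) ^ s) ≤ cst ν) :
    ∃ c : ℝ, 0 < c ∧ c ≤ 1 ∧ ∀ ν : ℕ, ENNReal.ofReal (c * (ν : ℝ) ^ s) ≤ cst ν := by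
  obtain ⟨c, hc, hev⟩ := hcst
  obtain ⟨N, hN⟩ := eventually_atTop.mp hev
  have hN0 : 0 < ((N : ℝ) + 1) ^ s := by positivity
  refine ⟨min (min c 1) (((N : ℝ) + 1) ^ s)⁻¹, by positivity,
    (min_le_left _ _).trans (min_le_right _ _), fun ν => ?_⟩
  rcases le_total N ν with h | h
  · refine le_trans (ENNReal.ofReal_le_ofReal ?_) (hN ν h)
    exact mul_le_mul_of_nonneg_right ((min_le_left _ _).trans (min_le_left _ _)) (by positivity)
  · refine le_trans ?_ (hone ν)
    rw [← ENNReal.ofReal_one]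
    refine ENNReal.ofReal_le_ofReal ?_
    calc _ ≤ (((N : ℝ) + 1) ^ s)⁻¹ * ((N : ℝ) + 1) ^ s := by
          refine mul_le_mul (min_le_right _ _) ?_ (by positivity) (by positivity)
          refine Real.rpow_le_rpow (by positivity) ?_ hs.le
          have : (ν : ℝ) ≤ N := by exact_mod_cast h
          linarith
      _ = 1 := inv_mul_cancel₀ hN0.ne'

theorem le_decay_of_polyBound [IsProbabilityMeasure ρ] (hk : (Matrix.of k).PosSemidef)
    (hkm : Measurable (Function.uncurry k)) (ha : k a a = 0)
    (hM : Integrable (fun x => k x x) ρ) (hγ : ∀ u, 0 ≤ γ u)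
    (hsum : Summable fun u : Finset ℕ+ => γ u * (∫ x, k x x ∂ρ) ^ u.card)
    {C₀ : ℝ} (hC₀ : C₀ = ∫ x, ∫ y, k x y ∂ρ ∂ρ) (hC₀_pos : 0 < C₀)
    (hone : ∀ ν, 1 ≤ cst ν) {s : ℝ} (hs : 0 < s)
    (hcst : ∃ c : ℝ, 0 < c ∧ ∀ᶠ ν : ℕ in atTop, ENNReal.ofReal (c * (ν : ℝ) ^ s) ≤ cst ν)
    {q₀ q : ℝ} (hpoly : (infProblem k a ρ γ cst).PolyBound (res (infProblem k a ρ γ cst) a cst) q₀)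
    (hq : 0 < q) (hq₀ : q₀ ≤ q) {σ : ℕ} {t C : ℝ} (ht : 0 ≤ t) (hC : 0 < C)
    (hS : ∀ v : Finset ℕ+,
      ({u : Finset ℕ+ | u.Nonempty ∧ 0 < cutOff γ σ u ∧ u ⊆ v}.ncard : ℝ) ≤
        C * (v.card : ℝ) ^ t) :
    ((1 + 2 / (q * max 1 (t / s)) : ℝ) : EReal) ≤ decay γ C₀ σ := by
  obtain ⟨c, hc, hc1, hcst⟩ := exists_cost_lower_bound hone hs hcst
  obtain ⟨B, hB, halg⟩ := hpoly.exists_algorithm hq₀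
  set τ := max 1 (t / s) with hτ
  have hτ1 : 1 ≤ τ := le_max_left _ _
  have hqτ : 0 < q * τ := by positivity
  set A := C * (B / c) ^ τ with hA
  have hA0 : 0 < A := by positivity
  refine le_decay_of_bound hγ hC₀_pos.le fun u hu =>
    ⟨2 * (2 * A) ^ (2 / (q * τ)), ?_⟩
  obtain ⟨L₀, hL₀⟩ := exists_nat_gt (2 * A)
  filter_upwards [eventually_ge_atTop L₀] with L hL
  have hLA : 2 * A < L := hL₀.trans_le (by exact_mod_cast hL)
  have hL0 : (0 : ℝ) < L := by linarith
  have hx0 : 0 < 2 * A / L := by positivity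
  have hx1 : 2 * A / L ≤ 1 := (div_le_one hL0).mpr hLA.le
  -- This `ε` makes the bound `A ε^{-qτ}` on the number of covered sets equal to `L / 2`; `L > 2A`
  -- ensures `ε ≤ 1`.
  set ε := (2 * A / L) ^ (1 / (q * τ)) with hε
  have hε0 : 0 < ε := Real.rpow_pos_of_pos hx0 _
  have hε1 : ε ≤ 1 := Real.rpow_le_one hx0.le hx1 (by positivity)
  obtain ⟨Q, hQ, herr, hcost⟩ := halg ε hε0 hε1
  obtain ⟨hran, n, v, hv, hle⟩ := exists_of_mem_res hk hγ hQ
  have hN : 0 ≤ B * ε ^ (-q) := by positivity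
  have hm : A * ε ^ (-(q * τ)) = L / 2 := by
    rw [hε, ← Real.rpow_mul hx0.le, show 1 / (q * τ) * -(q * τ) = -1 by field_simp,
      Real.rpow_neg_one]
    field_simp
  have key := hu.elim_mul_le (P := fun x => ∃ i, x ⊆ v i) (m := A * ε ^ (-(q * τ))) (E := ε ^ 2)
    (L := L) (by rw [hm]; linarith) (sq_nonneg _) ?_ ?_
  · have hε2 : ε ^ 2 = (2 * A) ^ (2 / (q * τ)) * (L : ℝ) ^ (-(2 / (q * τ))) := by
      rw [hε, ← Real.rpow_natCast, ← Real.rpow_mul hx0.le, Real.div_rpow (by positivity) hL0.le,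
        Real.rpow_neg hL0.le]
      rw [show 1 / (q * τ) * ((2 : ℕ) : ℝ) = 2 / (q * τ) by push_cast; ring, div_eq_mul_inv]
    rw [hε2, mul_div_assoc', div_le_iff₀ two_pos, ← le_div_iff₀ hL0] at key
    refine key.trans_eq ?_
    rw [neg_add, Real.rpow_add hL0, Real.rpow_neg_one]
    field_simp
  · intro G hG hGP
    have h := card_le_of_sum_cost_le hone hs hc hc1 hcst
      (S := {u | u.Nonempty ∧ 0 < cutOff γ σ u}) ht hC
      (fun v => by simpa only [Set.mem_ofPred_eq, and_assoc] using hS v) hN (hle.trans hcost)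
      hG hGP
    refine h.trans_eq ?_
    rw [hA, mul_div_right_comm, Real.mul_rpow (by positivity) (by positivity),
      ← Real.rpow_mul hε0.le, mul_assoc, neg_mul]
  · intro F _ hFP
    have h := ofReal_sum_le_error_sq hk hkm ha hM hγ hsum hC₀ hC₀_pos hran hv
      (F := F) fun x hx i hi => hFP x hx ⟨i, hi⟩
    have h2 : ENNReal.ofReal (∑ u ∈ F, γ u * C₀ ^ u.card) ≤ ENNReal.ofReal (ε ^ 2) := by
      rw [ENNReal.ofReal_pow hε0.le]
      exact h.trans (pow_le_pow_left' herr 2)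
    refine le_trans (Finset.sum_le_sum fun x _ => ?_)
      ((ENNReal.ofReal_le_ofReal_iff (sq_nonneg _)).mp h2)
    refine mul_le_mul_of_nonneg_right ?_ (pow_nonneg hC₀_pos.le _)
    rw [cutOff]
    split_ifs
    exacts [le_rfl, hγ x]

end DecayBound

/-! ### Simulating an algorithm on lifted integrands -/

namespace AdaptiveMethod

variable {X Y : Type*}

open Classical in
/-- The observed values with those at points outside of `S` replaced by `0`. -/
noncomputable def mask (A : AdaptiveMethod X) (S : Set X) (zs : List ℝ) : List ℝ :=
  zs.foldl (fun ys z => ys ++ [if ∃ x ∈ S, A.next ys = some x then z else 0]) []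

/-- The method for functions `f` on `Y` that applies `A` to the extension by zero of `f ∘ π`
from `S` to `X`. -/
noncomputable def pull (A : AdaptiveMethod X) (π : X → Y) (S : Set X) : AdaptiveMethod Y where
  next zs := (A.next (A.mask S zs)).map π
  output zs := A.output (A.mask S zs)

variable (A : AdaptiveMethod X) (π : X → Y) (S : Set X) (f : Y → ℝ)

/-- At a query `x ∉ S` the pulled method observes `f (π x)` where `A` would see `0`. Each query is
determined by the values corrected so far, so the true history can be rebuilt step by step. -/
theorem mask_history_pull (i : ℕ) : A.mask S ((A.pull π S).history f i) =
    A.history (extendZero S fun x : S => f (π x)) i := by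
  induction i with
  | zero => rfl
  | succ i ih =>
    simp only [history, pull] at ih ⊢
    rw [ih]
    rcases hx : A.next (A.history (extendZero S fun x : S => f (π x)) i) with _ | x
    · simpa using ih
    · simp only [Option.map_some]
      rw [mask, List.foldl_append, ← mask, ih]
      simp only [List.foldl_cons, List.foldl_nil]
      by_cases hS : x ∈ S
      · have h1 : extendZero S (fun x : S => f (π x)) x = f (π x) :=
          Subtype.val_injective.extend_apply (fun x : S => f (π x)) 0 ⟨x, hS⟩
        rw [h1, if_pos ⟨x, hS, hx⟩]
      · have h1 : extendZero S (fun x : S => f (π x)) x = 0 :=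
          Function.extend_apply' _ _ _ fun ⟨y, hy⟩ => hS (hy ▸ y.2)
        rw [h1, if_neg]
        rintro ⟨y, hy, hxy⟩
        exact hS (Option.some_injective _ (hx.symm.trans hxy) ▸ hy)

theorem node_pull (i : ℕ) : (A.pull π S).node f i =
    (A.node (extendZero S fun x : S => f (π x)) i).map π := by
  rw [node, node, ← mask_history_pull]
  rfl

theorem result_pull : (A.pull π S).result f =
    A.result (extendZero S fun x : S => f (π x)) := by
  classical
  have hnode : ∀ i, (A.pull π S).node f i = none ↔
      A.node (extendZero S fun x : S => f (π x)) i = none := fun i => by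
    rw [node_pull, Option.map_eq_none_iff]
  by_cases h : ∃ i, A.node (extendZero S fun x : S => f (π x)) i = none
  · have h' : ∃ i, (A.pull π S).node f i = none := h.imp fun i => (hnode i).mpr
    have hfind : Nat.find h' = Nat.find h := Nat.find_congr' fun {i} => hnode i
    rw [result, result, dif_pos h, dif_pos h', hfind, ← mask_history_pull]
    rfl
  · have h' : ¬∃ i, (A.pull π S).node f i = none := fun ⟨i, hi⟩ => h ⟨i, (hnode i).mp hi⟩
    rw [result, result, dif_neg h, dif_neg h']

variable {A f} in
theorem node_eq_none_of_le {g : X → ℝ} {n i : ℕ} (hn : A.node g n = none) (hi : n ≤ i) :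
    A.node g i = none := by
  induction i, hi using Nat.le_induction with
  | base => exact hn
  | succ i _ ih =>
    have : A.history g (i + 1) = A.history g i := by
      rw [node] at ih
      simp only [history]
      rw [ih]
    rw [node, this]
    exact ih

variable {A} in
theorem cost_const {g : X → ℝ} {n : ℕ} (hn : A.node g n = none)
    (h : ∀ i < n, A.node g i ≠ none) (c : ℝ≥0∞) : A.cost g (fun _ => c) = n * c := by
  rw [cost, tsum_eq_sum (s := Finset.range n)]
  · rw [Finset.sum_congr rfl (g := fun _ => c)]
    · simp
    · intro i hi
      obtain ⟨x, hx⟩ := Option.ne_none_iff_exists'.mp (h i (Finset.mem_range.mp hi))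
      rw [hx]
      rfl
  · intro i hi
    rw [node_eq_none_of_le hn (by simpa using hi)]
    rfl

end AdaptiveMethod

/-- The randomized version of `AdaptiveMethod.pull`. -/
noncomputable def RandomizedAlgorithm.pull {X Y : Type*} (Q : RandomizedAlgorithm X) (π : X → Y) (S : Set X) :
    RandomizedAlgorithm Y where
  Ω := Q.Ω
  P := Q.P
  method ω := (Q.method ω).pull π S

/-! ### Comparison with univariate integration -/

section Univariate

variable {D : Set ℝ} {k : D → D → ℝ} {a : D} {ρ : Measure D} [IsProbabilityMeasure ρ]
  {γ : Finset ℕ+ → ℝ} {cst : ℕ → ℝ≥0∞}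

/-- Univariate integration is not harder than infinite-dimensional integration. -/
theorem exists_univariate_algorithm (hk : (Matrix.of k).PosSemidef)
    (hkm : Measurable (Function.uncurry k))
    (hM : Integrable (fun x => k x x) ρ) (hγ : ∀ u, 0 ≤ γ u)
    (hsum : Summable fun u : Finset ℕ+ => γ u * (∫ x, k x x ∂ρ) ^ u.card)
    (hone : ∀ ν, 1 ≤ cst ν) {Q : RandomizedAlgorithm (ℕ+ → D)}
    (hQ : Q ∈ res (infProblem k a ρ γ cst) a cst) :
    ∃ Q' ∈ (uniProblem (fun x y => γ {1} * k x y) ρ (cst 1)).ran,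
      (uniProblem (fun x y => γ {1} * k x y) ρ (cst 1)).worstCost Q' ≤
        cst 1 * (infProblem k a ρ γ cst).worstCost Q ∧
      (uniProblem (fun x y => γ {1} * k x y) ρ (cst 1)).error Q' ≤
        (infProblem k a ρ γ cst).error Q := by
  obtain ⟨hran, n, v, hv, hle⟩ := exists_of_mem_res hk hγ hQ
  have hlift : ∀ f ∈ kernelSpace fun x y => γ {1} * k x y,
      extendZero (domain k γ) (fun x : domain k γ => f ((x : ℕ+ → D) 1)) ∈
        (infProblem k a ρ γ cst).space := fun f hf => ⟨_, lift_mem_kernelSpace hk hγ hf, rfl⟩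
  have hcost : ∀ f ∈ kernelSpace fun x y => γ {1} * k x y, ∀ᵐ ω ∂Q.P,
      ((Q.pull (fun x => x 1) (domain k γ)).method ω).cost f (fun _ => cst 1) = n * cst 1 := by
    intro f hf
    filter_upwards [hv _ (hlift f hf)] with ω hω
    refine AdaptiveMethod.cost_const ?_ (fun i hi => ?_) _
    · exact (AdaptiveMethod.node_pull _ _ _ _ _).trans (by rw [hω.1]; rfl)
    · obtain ⟨x, -, hx⟩ := hω.2 ⟨i, hi⟩
      have : ((Q.pull (fun x => x 1) (domain k γ)).method ω).node f i = some (x 1) :=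
        (AdaptiveMethod.node_pull _ _ _ _ _).trans (by rw [hx]; rfl)
      simp [this]
  -- Each evaluation costs at least `1`, so the cost bounds the number of samples; the univariate
  -- cost is then `n * cst 1`.
  have hn : (n : ℝ≥0∞) ≤ (infProblem k a ρ γ cst).worstCost Q := by
    refine le_trans ?_ hle
    calc (n : ℝ≥0∞) = ∑ _i : Fin n, 1 := by simp
      _ ≤ _ := Finset.sum_le_sum fun i _ => hone _
  refine ⟨Q.pull (fun x => x 1) (domain k γ), fun f hf => ⟨?_, ?_⟩, ?_, ?_⟩
  · exact (memLp_congr_ae (Eventually.of_forall fun ω => AdaptiveMethod.result_pull _ _ _ _)).mpr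
      (hran _ (hlift f hf)).1
  · exact aemeasurable_const.congr ((hcost f hf).mono fun ω hω => hω.symm)
  · refine iSup₂_le fun f hf => ?_
    refine (lintegral_congr_ae (hcost f (kernelBall_subset_kernelSpace hf))).trans_le ?_
    change ∫⁻ _, _ ∂Q.P ≤ _
    rw [lintegral_const, measure_univ, mul_one, mul_comm]
    gcongr
  · refine ENNReal.rpow_le_rpow (iSup₂_le fun f hf => ?_) (by norm_num)
    refine le_iSup₂_of_le _ ⟨_, lift_mem_kernelBall hk hγ hf, rfl⟩ (le_of_eq ?_)
    have hkm' : ∀ y, Measurable fun x => γ {1} * k x y := fun y =>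
      (hkm.comp (measurable_id.prodMk measurable_const)).const_mul _
    have hfm : Measurable f :=
      measurable_of_mem_kernelSpace hkm' (kernelBall_subset_kernelSpace hf)
    have hI : ∫ x, f x ∂ρ = ∫ x in domain k γ,
        extendZero (domain k γ) (fun x : domain k γ => f ((x : ℕ+ → D) 1)) x
          ∂(Measure.infinitePi fun _ : ℕ+ => ρ) := by
      rw [setIntegral_extendZero (ae_mem_domain hk hM hγ hsum) fun x => f (x 1)]
      have h := Measure.infinitePi_map_eval (μ := fun _ : ℕ+ => ρ) 1
      conv_lhs => rw [← h]
      exact integral_map (φ := fun x : ℕ+ → D => x 1) (measurable_pi_apply _).aemeasurable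
        hfm.aestronglyMeasurable
    refine lintegral_congr fun ω => ?_
    change ENNReal.ofReal ((∫ x, f x ∂ρ - ((Q.method ω).pull _ _).result f) ^ 2) = _
    rw [hI, AdaptiveMethod.result_pull]
    rfl

theorem two_div_le_of_polyBound (hk : (Matrix.of k).PosSemidef)
    (hkm : Measurable (Function.uncurry k)) (ha : k a a = 0)
    (hM : Integrable (fun x => k x x) ρ) (hγ : ∀ u, 0 ≤ γ u)
    (hsum : Summable fun u : Finset ℕ+ => γ u * (∫ x, k x x ∂ρ) ^ u.card)
    {C₀ : ℝ} (hC₀ : C₀ = ∫ x, ∫ y, k x y ∂ρ ∂ρ) (hC₀_pos : 0 < C₀) (hγ₁ : 0 < γ {1})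
    (hmono : Monotone cst) (hone : ∀ ν, 1 ≤ cst ν) {α : ℝ} (hα : 0 < α)
    (huni : ∃ c : ℝ, 0 < c ∧ ∀ᶠ N : ℝ in atTop, ENNReal.ofReal (c * N ^ (-α / 2)) ≤
      (uniProblem (fun x y => γ {1} * k x y) ρ (cst 1)).minError
        (uniProblem (fun x y => γ {1} * k x y) ρ (cst 1)).ran N)
    {q₀ : ℝ}
    (hpoly : (infProblem k a ρ γ cst).PolyBound (res (infProblem k a ρ γ cst) a cst) q₀) :
    2 / α ≤ q₀ := by
  -- If `cst 1 = ⊤` the comparison of costs is void. But then finite cost and monotonicity force all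
  -- `v i` to be empty, `{1}` stays uncovered, and the squared error never drops below `γ {1} * C₀`.
  by_cases htop : cst 1 = ⊤
  · exfalso
    obtain ⟨B, hB, halg⟩ := hpoly.exists_algorithm le_rfl
    have hW : 0 < γ {1} * C₀ := by positivity
    set ε := min 1 (√(γ {1} * C₀) / 2) with hε
    have hε0 : 0 < ε := by positivity
    obtain ⟨Q, hQ, herr, hcost⟩ := halg ε hε0 (min_le_left _ _)
    obtain ⟨hran, n, v, hv, hle⟩ := exists_of_mem_res hk hγ hQ
    have hF : ∀ u ∈ ({{1}} : Finset (Finset ℕ+)), ∀ i, ¬u ⊆ v i := by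
      intro u hu i hi
      rw [Finset.mem_singleton.mp hu] at hi
      have h1 : cst 1 ≤ cst (v i).card := hmono (by simpa using Finset.card_le_card hi)
      have h2 := (Finset.single_le_sum (f := fun i => cst (v i).card) (fun _ _ => zero_le)
        (Finset.mem_univ i)).trans (hle.trans hcost)
      rw [htop] at h1
      exact (h1.trans h2).not_gt ENNReal.ofReal_lt_top
    have h := (ofReal_sum_le_error_sq hk hkm ha hM hγ hsum hC₀ hC₀_pos hran hv hF).trans
      (pow_le_pow_left' herr 2)
    rw [← ENNReal.ofReal_pow hε0.le, ENNReal.ofReal_le_ofReal_iff (sq_nonneg _)] at h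
    simp only [Finset.sum_singleton, Finset.card_singleton, pow_one] at h
    have h2 := pow_le_pow_left₀ hε0.le (min_le_right 1 (√(γ {1} * C₀) / 2)) 2
    rw [div_pow, Real.sq_sqrt hW.le] at h2
    linarith
  · by_contra! hlt
    obtain ⟨q, hq₀, hq⟩ := exists_between hlt
    have hq_pos : 0 < q := hpoly.1.trans_lt hq₀
    obtain ⟨B, hB, halg⟩ := hpoly.exists_algorithm hq₀.le
    obtain ⟨c, hc, hev⟩ := huni
    set c₁ := (cst 1).toReal with hc₁
    have hc₁1 : 1 ≤ c₁ := by simpa using ENNReal.toReal_mono htop (hone 1)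
    have hE : 0 < c₁ * B := by positivity
    have hlim : Tendsto (fun ε : ℝ => c₁ * B * ε ^ (-q)) (𝓝[>] 0) atTop :=
      (tendsto_rpow_neg_nhdsGT_zero (neg_lt_zero.mpr hq_pos)).const_mul_atTop hE
    -- With `N = c₁ B ε^{-q}` the univariate bound would give a constant times `ε^{qα/2} ≤ ε`, which
    -- fails for small `ε` because `qα/2 < 1`.
    have hexp : 0 < 1 - q * α / 2 := by
      rw [lt_div_iff₀ hα] at hq
      linarith
    have hzero : Tendsto (fun ε : ℝ => ε ^ (1 - q * α / 2)) (𝓝[>] 0) (𝓝 0) := by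
      have := (Real.continuousAt_rpow_const 0 (1 - q * α / 2) (Or.inr hexp.le)).tendsto
      rw [Real.zero_rpow hexp.ne'] at this
      exact this.mono_left nhdsWithin_le_nhds
    have hsmall := hzero.eventually (gt_mem_nhds
      (show 0 < c * (c₁ * B) ^ (-α / 2) by positivity))
    obtain ⟨ε, hε, hεev, hεsmall, hε1⟩ := 
      ((eventually_mem_nhdsWithin (a := (0 : ℝ)) (s := Set.Ioi 0)).and
        ((hlim.eventually hev).and (hsmall.and
          (nhdsWithin_le_nhds (Iic_mem_nhds (zero_lt_one' ℝ)))))).exists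
    have hε0 : 0 < ε := hε
    obtain ⟨Q, hQ, herr, hcost⟩ := halg ε hε0 hε1
    obtain ⟨Q', hQ', hcost', herr'⟩ := exists_univariate_algorithm hk hkm hM hγ hsum hone hQ
    have hN : (uniProblem (fun x y => γ {1} * k x y) ρ (cst 1)).worstCost Q' ≤
        ENNReal.ofReal (c₁ * B * ε ^ (-q)) := by
      rw [mul_assoc, ENNReal.ofReal_mul ENNReal.toReal_nonneg, ENNReal.ofReal_toReal htop]
      exact hcost'.trans (mul_le_mul_right hcost _)
    have h := (hεev.trans (sInf_le ⟨Q', hQ', hN, rfl⟩)).trans (herr'.trans herr)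
    rw [ENNReal.ofReal_le_ofReal_iff hε0.le, Real.mul_rpow hE.le (by positivity),
      ← Real.rpow_mul hε0.le, ← mul_assoc, show -q * (-α / 2) = q * α / 2 by ring] at h
    rw [Real.rpow_sub hε0, Real.rpow_one, div_lt_iff₀ (by positivity)] at hεsmall
    exact h.not_gt hεsmall

end Univariate

/-- Solves the decay bound for `q` and passes to the infimum over `t`. Arguing by contradiction
covers an infimum equal to `0` or `∞`, and an empty `T`, without separate cases. -/
theorem two_mul_min_div_le {s : ℝ} (hs : 0 < s) {q₀ : ℝ} (hq₀ : 0 ≤ q₀) {d : EReal} (hd : 1 < d)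
    {T : Set ℝ} (hT : ∀ t ∈ T, ∀ q : ℝ, 0 < q → q₀ ≤ q →
      ((1 + 2 / (q * max 1 (t / s)) : ℝ) : EReal) ≤ d) :
    2 * ((min 1 (ENNReal.ofReal s / sInf (ENNReal.ofReal '' T)) : ℝ≥0∞) : EReal) / (d - 1) ≤
      q₀ := by
  set z : ℝ≥0∞ := min 1 (ENNReal.ofReal s / sInf (ENNReal.ofReal '' T)) with hz
  induction d with
  | bot => exact absurd hd not_lt_bot
  | top =>
    rw [← EReal.coe_one, EReal.top_sub_coe, EReal.div_top]
    exact_mod_cast hq₀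
  | coe d =>
    have hd1 : 1 < d := by exact_mod_cast hd
    have hz1 : z ≤ 1 := min_le_left _ _
    have hztop : z ≠ ⊤ := (hz1.trans_lt ENNReal.one_lt_top).ne
    have hcoe : 2 * (z : EReal) / ((d : EReal) - 1) = ((2 * z.toReal / (d - 1) : ℝ) : EReal) := by
      rw [EReal.coe_div, EReal.coe_mul, EReal.coe_sub, EReal.coe_ennreal_toReal hztop]
      rfl
    rw [hcoe, EReal.coe_le_coe_iff]
    by_contra! hlt
    obtain ⟨q, hq₀q, hq⟩ := exists_between hlt
    have hq_pos : 0 < q := hq₀.trans_lt hq₀q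
    have hd0 : 0 < d - 1 := sub_pos.mpr hd1
    rw [lt_div_iff₀ hd0] at hq
    -- The hypothesis reads `1 ≤ x * max 1 (t / s)`. Since `x < z ≤ 1`, the maximum must be `t / s`,
    -- so every admissible `t` is at least `s / x`; this forces `z ≤ x`.
    set x := q * (d - 1) / 2 with hx
    have hx0 : 0 < x := by positivity
    have hxz : x < z.toReal := by linarith
    have hx1 : x < 1 := hxz.trans_le (by simpa using ENNReal.toReal_mono ENNReal.one_ne_top hz1)
    have ht : ∀ t ∈ T, s / x ≤ t := by
      intro t htT
      have h := hT t htT q hq_pos hq₀q.le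
      rw [EReal.coe_le_coe_iff, ← le_sub_iff_add_le',
        div_le_iff₀ (mul_pos hq_pos (zero_lt_one.trans_le (le_max_left _ _)))] at h
      have h1 : 1 ≤ x * max 1 (t / s) := by rw [hx]; linarith
      rcases le_total (t / s) 1 with hts | hts
      · rw [max_eq_left hts] at h1
        linarith
      · rw [max_eq_right hts, mul_div_assoc', one_le_div hs] at h1
        rwa [div_le_iff₀ hx0, mul_comm]
    have hinf : ENNReal.ofReal (s / x) ≤ sInf (ENNReal.ofReal '' T) := by
      refine le_sInf ?_
      rintro _ ⟨t, htT, rfl⟩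
      exact ENNReal.ofReal_le_ofReal (ht t htT)
    have hzx : z ≤ ENNReal.ofReal x := by
      refine (min_le_right _ _).trans ((ENNReal.div_le_div_left hinf _).trans_eq ?_)
      rw [← ENNReal.ofReal_div_of_pos (by positivity)]
      congr 1
      field_simp
    exact hxz.not_ge (ENNReal.toReal_le_of_le_ofReal hx0.le hzx)

/-- Shows that `t = σ` is always an admissible growth exponent, whatever the weights. -/
theorem ncard_cutOff_subsets_le (γ : Finset ℕ+ → ℝ) (σ : ℕ+) (v : Finset ℕ+) :
    ({u : Finset ℕ+ | u.Nonempty ∧ 0 < cutOff γ σ u ∧ u ⊆ v}.ncard : ℝ) ≤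
      1 * (v.card : ℝ) ^ ((σ : ℕ) : ℝ) := by
  rw [one_mul]
  refine le_trans (Nat.cast_le.mpr (Set.ncard_le_ncard ?_ ?_)) (ncard_subsets_le σ v)
  · rintro u ⟨hne, hpos, huv⟩
    refine ⟨⟨hne, ?_⟩, huv⟩
    by_contra h
    rw [cutOff, if_neg h] at hpos
    exact lt_irrefl _ hpos
  · exact v.powerset.finite_toSet.subset fun u hu => by simpa using hu.2

end InfInt

theorem theorem3p1
    (D : Set ℝ) (hD : MeasurableSet D)
    (k : D → D → ℝ) (hk : (Matrix.of k).PosSemidef) (hkm : Measurable (Function.uncurry k))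
    (a : D) (ha : k a a = 0)
    (ρ : Measure D) [IsProbabilityMeasure ρ]
    (hM : Integrable (fun x => k x x) ρ)
    (γ : Finset ℕ+ → ℝ) (hγ : ∀ u, 0 ≤ γ u)
    (hsum : Summable fun u : Finset ℕ+ => γ u * (∫ x, k x x ∂ρ) ^ u.card)
    (C₀ : ℝ) (hC₀ : C₀ = ∫ x, ∫ y, k x y ∂ρ ∂ρ) (hC₀_pos : 0 < C₀)
    (hγ₁ : 0 < γ {1})
    (cst : ℕ → ℝ≥0∞) (hmono : Monotone cst) (hone : ∀ ν, 1 ≤ cst ν)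
    (s : ℝ) (hs : 0 < s)
    (hcst : ∃ c : ℝ, 0 < c ∧ ∀ᶠ ν : ℕ in atTop, ENNReal.ofReal (c * (ν : ℝ) ^ s) ≤ cst ν)
    (α : ℝ) (hα : 0 < α)
    (huni : ∃ c : ℝ, 0 < c ∧ ∀ᶠ N : ℝ in atTop,
      ENNReal.ofReal (c * N ^ (-α / 2)) ≤
        (InfInt.uniProblem (fun x y => γ {1} * k x y) ρ (cst 1)).minError
          (InfInt.uniProblem (fun x y => γ {1} * k x y) ρ (cst 1)).ran N) :
    let p := InfInt.infProblem k a ρ γ cst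
    let 𝒜 := InfInt.res p a cst
    (p.StronglyTractable 𝒜 → ∀ σ : ℕ+, 1 < InfInt.decay γ C₀ σ) ∧
    ((∀ σ : ℕ+, 1 < InfInt.decay γ C₀ σ) →
      max ((2 / α : ℝ) : EReal)
        (⨆ σ : ℕ+, (2 * ((min 1 (ENNReal.ofReal s / InfInt.tStar γ σ) : ℝ≥0∞) : EReal)) /
          (InfInt.decay γ C₀ σ - 1))
      ≤ p.exponent 𝒜) := by

  intro p 𝒜
  have hdecay : ∀ {q₀ q : ℝ}, p.PolyBound 𝒜 q₀ → 0 < q → q₀ ≤ q → ∀ {σ : ℕ} {t C : ℝ},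
      0 ≤ t → 0 < C → (∀ v : Finset ℕ+,
        ({u : Finset ℕ+ | u.Nonempty ∧ 0 < InfInt.cutOff γ σ u ∧ u ⊆ v}.ncard : ℝ) ≤
          C * (v.card : ℝ) ^ t) →
      ((1 + 2 / (q * max 1 (t / s)) : ℝ) : EReal) ≤ InfInt.decay γ C₀ σ :=
    fun hpoly hq hq₀ _ _ _ ht hC hS =>
      InfInt.le_decay_of_polyBound hk hkm ha hM hγ hsum hC₀ hC₀_pos hone hs hcst hpoly hq hq₀ ht
        hC hS
  refine ⟨?_, fun hd => le_sInf ?_⟩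
  · rintro ⟨q₀, hpoly⟩ σ
    -- The decay bound needs a positive exponent, while `q₀` may be `0`.
    have hq : 0 < q₀ + 1 := by linarith [hpoly.1]
    refine lt_of_lt_of_le ?_ (hdecay hpoly hq (by linarith) (Nat.cast_nonneg _) one_pos
      (InfInt.ncard_cutOff_subsets_le γ σ))
    have : 0 < 2 / ((q₀ + 1) * max 1 (((σ : ℕ) : ℝ) / s)) := by positivity
    exact_mod_cast lt_add_of_pos_right 1 this
  · rintro _ ⟨q₀, hpoly, rfl⟩
    refine max_le ?_ (iSup_le fun σ => ?_)
    · exact EReal.coe_le_coe_iff.mpr (InfInt.two_div_le_of_polyBound hk hkm ha hM hγ hsum hC₀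
        hC₀_pos hγ₁ hmono hone hα huni hpoly)
    · refine InfInt.two_mul_min_div_le hs hpoly.1 (hd σ) ?_
      rintro t ⟨ht, C, hC, hS⟩ q hq hq₀
      exact hdecay hpoly hq hq₀ ht hC hS
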